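/- Fix a dyadic lattice $\mathcal D$ on $\mathbb R$ determined by an arbitrary root interval $[a,a+r)$, $r>0$: $\mathcal D$ consists of the intervals $[a+2^n r k,\,a+2^n r(k+1))$, $n,k\in\mathbb Z$. For $I\in\mathcal D$ let $\mathcal D(I)=\{J\in\mathcal D: J\subseteq I\}$, let $\langle w\rangle_J=\frac1{|J|}\int_J w$, and let $\Delta_J w=\langle w\rangle_{J^-}-\langle w\rangle_{J^+}$, where $J^\pm$ are the two halves of $J$. A weight is a locally integrable function on $\mathbb R$ that is positive almost everywhere. A weight $w$ belongs to $A_2^d$ if $w^{-1}$ is also a weight and $[w]_{A_2^d}=\sup_{J\in\mathcal D}\langle w\rangle_J\langle w^{-1}\rangle_J<\infty$. The Carleson norm of a non-negative sequence $\{c_J\}_{J\in\mathcal D}$ is $$\|\{c_J\}\|_{\mathcal C}=\sup_{I\in\mathcal D}\frac1{|I|}\sum_{J\in\mathcal D(I)}c_J\in[0,\infty].$$ For $\Phi:[1,\infty)\to[0,\infty)$ and $w\in A_2^d$ put $$c_J^\Phi(w)=|J|\,\Phi\big(\langle w\rangle_J\langle w^{-1}\rangle_J\big)\left[\frac{(\Delta_Jw)^2}{\langle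 w\rangle_J^2}+\frac{(\Delta_Jw^{-1})^2}{\langle w^{-1}\rangle_J^2}\right],$$ $$K_\Phi(Q)=\sup\big\{\|\{c_J^\Phi(w)\}\|_{\mathcal C}: w\in A_2^d,\ [w]_{A_2^d}=Q\big\},\qquad Q\ge1,$$ and $h(s)=\Phi(s^2)/s^2$ for $s\ge1$. **Theorem.** Let $\Phi:[1,\infty)\to[0,\infty)$ and $Q\ge1$. Monotonicity is understood in the non-strict sense, and monotonicity of $\Phi$ and convexity or concavity of $h$ are meant on $[1,\infty)$. 1. If $\Phi$ is increasing and $h$ is convex, then $$K_\Phi(Q)=16\,\Phi(Q)\Big(1-\frac1{\sqrt Q}\Big)+8\int_1^Q\frac{\Phi(y)}y\Big(1-\frac1{\sqrt y}\Big)\,dy.$$ 2. If $\Phi$ is increasing and $h$ is concave, then $$K_\Phi(Q)\le 8(\sqrt Q-1)(3\sqrt Q-1)\,h(s_0(Q)),\qquad s_0(Q)=\frac{8Q-\sqrt Q-1}{3(3\sqrt Q-1)}.$$ 3. If $\Phi$ is decreasing, then $$K_\Phi(Q)=8\int_1^Q\frac{\Phi(y)}y\,dy.$$ -/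

import Mathlib

open MeasureTheory
open scoped ENNReal

/-- A dyadic lattice on the line, determined by its root interval `[origin, origin + size)`. -/
structure DyadicLattice where
  origin : ℝ
  size : ℝ
  size_pos : 0 < size

namespace DyadicLattice

/-- The length of the dyadic interval with index `J = (n, k)`, that is `2 ^ n * size`
(`n` ranges over all integers, so there are arbitrarily small and arbitrarily large intervals). -/
noncomputable def length (D : DyadicLattice) (J : ℤ × ℤ) : ℝ :=
  (2 : ℝ) ^ J.1 * D.size

/-- The dyadic interval with index `J = (n, k)`: the `k`-th translate of
`[origin, origin + 2 ^ n * size)`. Different indices give different intervals. -/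
noncomputable def interval (D : DyadicLattice) (J : ℤ × ℤ) : Set ℝ :=
  Set.Ico (D.origin + (J.2 : ℝ) * D.length J) (D.origin + ((J.2 : ℝ) + 1) * D.length J)

/-- The indices of the dyadic subintervals of `I`, `I` itself included. -/
def subintervals (D : DyadicLattice) (I : ℤ × ℤ) : Set (ℤ × ℤ) :=
  {J | D.interval J ⊆ D.interval I}

/-- The index of the left half of a dyadic interval. -/
def leftHalf (J : ℤ × ℤ) : ℤ × ℤ := (J.1 - 1, 2 * J.2)

/-- The index of the right half of a dyadic interval. -/
def rightHalf (J : ℤ × ℤ) : ℤ × ℤ := (J.1 - 1, 2 * J.2 + 1)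

/-- The average of `w` over the dyadic interval `J`. -/
noncomputable def avg (D : DyadicLattice) (w : ℝ → ℝ) (J : ℤ × ℤ) : ℝ :=
  ⨍ x in D.interval J, w x

/-- The difference of the averages over the left and the right half of `J`. -/
noncomputable def delta (D : DyadicLattice) (w : ℝ → ℝ) (J : ℤ × ℤ) : ℝ :=
  D.avg w (leftHalf J) - D.avg w (rightHalf J)

end DyadicLattice

/-- A weight: a locally integrable function that is positive almost everywhere. -/
def IsWeight (w : ℝ → ℝ) : Prop :=
  LocallyIntegrable w volume ∧ ∀ᵐ x ∂(volume : Measure ℝ), 0 < w x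

/-- The dyadic `A₂` characteristic: the supremum of `⟨w⟩_J ⟨w⁻¹⟩_J` over all dyadic `J`
(used only when `w` and `w⁻¹` are both locally integrable). -/
noncomputable def a2Char (D : DyadicLattice) (w : ℝ → ℝ) : ℝ≥0∞ :=
  ⨆ J : ℤ × ℤ, ENNReal.ofReal (D.avg w J * D.avg w⁻¹ J)

/-- The dyadic Muckenhoupt class `A₂`. The averages of the reciprocal have to be finite, so the
reciprocal is a weight too. -/
def MemA2 (D : DyadicLattice) (w : ℝ → ℝ) : Prop :=
  IsWeight w ∧ IsWeight w⁻¹ ∧ a2Char D w < ∞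

/-- The Carleson norm of a non-negative sequence indexed by the dyadic intervals, with value `∞`
if the sequence is not Carleson. -/
noncomputable def carlesonNorm (D : DyadicLattice) (c : ℤ × ℤ → ℝ) : ℝ≥0∞ :=
  ⨆ I : ℤ × ℤ,
    (∑' J : D.subintervals I, ENNReal.ofReal (c J)) / ENNReal.ofReal (D.length I)

/-- The Carleson norm is the smallest admissible constant. -/
theorem isLeast_carlesonNorm (D : DyadicLattice) (c : ℤ × ℤ → ℝ) :
    IsLeast {C : ℝ≥0∞ | ∀ I : ℤ × ℤ,
      (∑' J : D.subintervals I, ENNReal.ofReal (c J)) / ENNReal.ofReal (D.length I) ≤ C}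
      (carlesonNorm D c) :=
  ⟨fun I => le_iSup (fun I : ℤ × ℤ =>
      (∑' J : D.subintervals I, ENNReal.ofReal (c J)) / ENNReal.ofReal (D.length I)) I,
    fun _ hC => iSup_le hC⟩

/-- The sequence `c_J^Φ(w) =
|J| Φ(⟨w⟩_J ⟨w⁻¹⟩_J) ((Δ_J w)² / ⟨w⟩_J² + (Δ_J w⁻¹)² / ⟨w⁻¹⟩_J²)`. -/
noncomputable def cSeq (D : DyadicLattice) (Φ : ℝ → ℝ) (w : ℝ → ℝ) (J : ℤ × ℤ) : ℝ :=
  D.length J * Φ (D.avg w J * D.avg w⁻¹ J) *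
    ((D.delta w J) ^ 2 / (D.avg w J) ^ 2 + (D.delta w⁻¹ J) ^ 2 / (D.avg w⁻¹ J) ^ 2)

/-- `K_Φ(Q)`: the supremum of the Carleson norms of `c^Φ(w)` over all `w` in dyadic `A₂` with
characteristic exactly `Q`. -/
noncomputable def upperK (D : DyadicLattice) (Φ : ℝ → ℝ) (Q : ℝ) : ℝ≥0∞ :=
  ⨆ (w : ℝ → ℝ) (_ : MemA2 D w ∧ a2Char D w = ENNReal.ofReal Q), carlesonNorm D (cSeq D Φ w)

/-- The function `h(s) = Φ(s²) / s²`. -/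
noncomputable def hFun (Φ : ℝ → ℝ) (s : ℝ) : ℝ := Φ (s ^ 2) / s ^ 2

/-- The point `s₀(Q) = (8Q - √Q - 1) / (3 (3√Q - 1))`. -/
noncomputable def sZero (Q : ℝ) : ℝ := (8 * Q - √Q - 1) / (3 * (3 * √Q - 1))

/-! The method is a Bellman function of the single variable `y = ⟨w⟩_J ⟨w⁻¹⟩_J`. With `u = Δ_J w /
(2⟨w⟩_J)` and `v = Δ_J w⁻¹ / (2⟨w⁻¹⟩_J)`, the halves of `J` carry the products `y(1+u)(1+v)` and
`y(1-u)(1-v)`, and `c_J / |J| = 4Φ(y)(u² + v²)`. A function `b ≥ 0` on `[1, Q]` that is largest at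
`Q` and loses at least this much on average at each split bounds `K_Φ(Q)` by `b Q`
(`upperK_le_of_supersolution`). Conversely, weights glued from halves realize any admissible
splitting scheme (`Attains.glue`, `Attains.le_upperK`).

For decreasing `Φ`, `b y = 8 ∫₁^y Φ(t)/t dt` is concave in `log y`, and `log(1-u²) ≤ -u²` gives the
inequality. Small splits with `v = -u` send both halves to the same product, and are asymptotically
optimal.

For increasing `Φ` the natural variable is `s = √y`. If `p, q, r` are the roots for the two halves
and for `J`, then `pq ≤ r²(1 - (u²+v²)/2)` and `p + q ≤ 2r`. For convex `h` the function
`greenPotential` is a supersolution (`greenPotential_supersolution`). The matching scheme is a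
random walk in `s`: splits with `u = v` move `s` by `±d`, a split with `v = -u` reflects it at `√Q`,
and `s = 1` absorbs. The limit `d → 0` of its expected reward (`attains_walk`) is the potential at
`√Q`.

For concave `h` the convex bound is applied to the tangent line of `h` at `s₀(Q)`, the point at
which the slope drops out of the bound. -/

namespace DyadicLattice

/-! ### Dyadic intervals and averages. -/

variable (D : DyadicLattice)

theorem length_pos (J : ℤ × ℤ) : 0 < D.length J :=
  mul_pos (zpow_pos two_pos _) D.size_pos

theorem length_half (n k l : ℤ) : D.length (n - 1, k) = D.length (n, l) / 2 := by
  simp only [length]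
  rw [zpow_sub_one₀ two_ne_zero]
  ring

theorem interval_leftHalf (J : ℤ × ℤ) :
    D.interval (leftHalf J) =
      Set.Ico (D.origin + J.2 * D.length J) (D.origin + (J.2 + 1 / 2) * D.length J) := by
  obtain ⟨n, k⟩ := J
  simp only [interval, leftHalf, D.length_half n _ k]
  push_cast
  congr 1 <;> ring

theorem interval_rightHalf (J : ℤ × ℤ) :
    D.interval (rightHalf J) =
      Set.Ico (D.origin + (J.2 + 1 / 2) * D.length J) (D.origin + (J.2 + 1) * D.length J) := by
  obtain ⟨n, k⟩ := J
  simp only [interval, rightHalf, D.length_half n _ k]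
  push_cast
  congr 1 <;> ring

theorem length_leftHalf (J : ℤ × ℤ) : D.length (leftHalf J) = D.length J / 2 :=
  D.length_half _ _ _

theorem length_rightHalf (J : ℤ × ℤ) : D.length (rightHalf J) = D.length J / 2 :=
  D.length_half _ _ _

theorem interval_eq_union (J : ℤ × ℤ) :
    D.interval J = D.interval (leftHalf J) ∪ D.interval (rightHalf J) := by
  have := D.length_pos J
  rw [interval_leftHalf, interval_rightHalf, Set.Ico_union_Ico_eq_Ico]
  · rfl
  · nlinarith
  · nlinarith

theorem disjoint_halves (J : ℤ × ℤ) :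
    Disjoint (D.interval (leftHalf J)) (D.interval (rightHalf J)) := by
  rw [interval_leftHalf, interval_rightHalf]
  exact Set.Ico_disjoint_Ico_same

theorem interval_nonempty (J : ℤ × ℤ) : (D.interval J).Nonempty := by
  have := D.length_pos J
  exact Set.nonempty_Ico.2 (by nlinarith)

theorem measurableSet_interval (J : ℤ × ℤ) : MeasurableSet (D.interval J) := measurableSet_Ico

theorem volume_interval (J : ℤ × ℤ) : volume (D.interval J) = ENNReal.ofReal (D.length J) := by
  rw [interval, Real.volume_Ico]
  congr 1
  ring

theorem volume_real_interval (J : ℤ × ℤ) : volume.real (D.interval J) = D.length J := by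
  rw [measureReal_def, volume_interval, ENNReal.toReal_ofReal (D.length_pos J).le]

theorem interval_subset_iff (J I : ℤ × ℤ) : D.interval J ⊆ D.interval I ↔
    J.1 ≤ I.1 ∧ I.2 * 2 ^ (I.1 - J.1).toNat ≤ J.2 ∧ J.2 + 1 ≤ (I.2 + 1) * 2 ^ (I.1 - J.1).toNat := by
  obtain ⟨m, l⟩ := J
  obtain ⟨n, k⟩ := I
  have hJ := D.length_pos (m, l)
  have hI := D.length_pos (n, k)
  rw [interval, interval, Set.Ico_subset_Ico_iff (by nlinarith)]
  have key : ∀ j : ℕ, n - m = j → D.length (n, k) = 2 ^ j * D.length (m, l) := by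
    intro j hj
    simp only [length]
    rw [show n = j + m by omega, zpow_add₀ two_ne_zero, zpow_natCast]
    ring
  dsimp only
  constructor
  · rintro ⟨h1, h2⟩
    have hle : D.length (m, l) ≤ D.length (n, k) := by nlinarith
    have hmn : m ≤ n := by
      simp only [length] at hle
      have := le_of_mul_le_mul_right hle D.size_pos
      exact (zpow_le_zpow_iff_right₀ one_lt_two).1 this
    obtain ⟨j, hj⟩ := Int.eq_ofNat_of_zero_le (sub_nonneg.2 hmn)
    have hk := key j hj
    rw [hk] at h1 h2
    refine ⟨hmn, ?_, ?_⟩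
    · rw [hj, Int.toNat_natCast]
      have : (k * 2 ^ j : ℝ) ≤ l := le_of_mul_le_mul_right (by linarith) hJ
      exact_mod_cast this
    · rw [hj, Int.toNat_natCast]
      have : (l + 1 : ℝ) ≤ (k + 1) * 2 ^ j := le_of_mul_le_mul_right (by linarith) hJ
      exact_mod_cast this
  · rintro ⟨hmn, h1, h2⟩
    obtain ⟨j, hj⟩ := Int.eq_ofNat_of_zero_le (sub_nonneg.2 hmn)
    have hk := key j hj
    rw [hk]
    rw [hj, Int.toNat_natCast] at h1 h2
    have h1' : (k * 2 ^ j : ℝ) ≤ l := by exact_mod_cast h1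
    have h2' : (l + 1 : ℝ) ≤ (k + 1) * 2 ^ j := by exact_mod_cast h2
    constructor <;> nlinarith

theorem mem_subintervals {I J : ℤ × ℤ} : J ∈ D.subintervals I ↔ D.interval J ⊆ D.interval I :=
  Iff.rfl

theorem leftHalf_subset (J : ℤ × ℤ) : D.interval (leftHalf J) ⊆ D.interval J := by
  rw [D.interval_eq_union J]; exact Set.subset_union_left

theorem rightHalf_subset (J : ℤ × ℤ) : D.interval (rightHalf J) ⊆ D.interval J := by
  rw [D.interval_eq_union J]; exact Set.subset_union_right

theorem subintervals_eq (I : ℤ × ℤ) : D.subintervals I =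
    {I} ∪ (D.subintervals (leftHalf I) ∪ D.subintervals (rightHalf I)) := by
  ext J
  simp only [Set.mem_union, Set.mem_singleton_iff, mem_subintervals]
  constructor
  · intro h
    rw [interval_subset_iff] at h
    simp only [interval_subset_iff]
    obtain ⟨m, l⟩ := J
    obtain ⟨n, k⟩ := I
    simp only [leftHalf, rightHalf, Prod.mk.injEq] at h ⊢
    obtain ⟨hmn, h1, h2⟩ := h
    obtain ⟨j, hj⟩ := Int.eq_ofNat_of_zero_le (sub_nonneg.2 hmn)
    rw [hj, Int.toNat_natCast] at h1 h2
    rcases j with _ | j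
    · left
      simp at h1 h2 hj
      omega
    · right
      have hj' : n - 1 - m = (j : ℤ) := by push_cast at hj; omega
      rw [hj', Int.toNat_natCast]
      rw [pow_succ] at h1 h2
      have : m ≤ n - 1 := by omega
      generalize (2 : ℤ) ^ j = a at *
      rcases le_or_gt (l + 1) ((2 * k + 1) * a) with h | h
      · left
        exact ⟨this, by linarith, h⟩
      · right
        exact ⟨this, by linarith, by linarith⟩
  · rintro (rfl | h | h)
    · exact subset_rfl
    · exact h.trans (D.leftHalf_subset I)
    · exact h.trans (D.rightHalf_subset I)

theorem fst_le_of_mem {I J : ℤ × ℤ} (h : J ∈ D.subintervals I) : J.1 ≤ I.1 :=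
  ((D.interval_subset_iff J I).1 h).1

theorem disjoint_subintervals_halves (I : ℤ × ℤ) :
    Disjoint (D.subintervals (leftHalf I)) (D.subintervals (rightHalf I)) := by
  rw [Set.disjoint_left]
  intro J h1 h2
  obtain ⟨t, ht⟩ := D.interval_nonempty J
  exact Set.disjoint_left.1 (D.disjoint_halves I) (h1 ht) (h2 ht)

theorem disjoint_singleton_subintervals (I : ℤ × ℤ) :
    Disjoint {I} (D.subintervals (leftHalf I) ∪ D.subintervals (rightHalf I)) := by
  rw [Set.disjoint_singleton_left]
  rintro (h | h)
  · have := D.fst_le_of_mem h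
    simp [leftHalf] at this
  · have := D.fst_le_of_mem h
    simp [rightHalf] at this

theorem tsum_subintervals (c : ℤ × ℤ → ℝ≥0∞) (I : ℤ × ℤ) :
    ∑' J : D.subintervals I, c J = c I +
      (∑' J : D.subintervals (leftHalf I), c J + ∑' J : D.subintervals (rightHalf I), c J) := by
  rw [D.subintervals_eq I, ENNReal.summable.tsum_union_disjoint
    (D.disjoint_singleton_subintervals I) ENNReal.summable,
    ENNReal.summable.tsum_union_disjoint (D.disjoint_subintervals_halves I) ENNReal.summable]
  simp

theorem integrableOn_interval {w : ℝ → ℝ} (hw : LocallyIntegrable w volume) (J : ℤ × ℤ) :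
    IntegrableOn w (D.interval J) :=
  (hw.integrableOn_isCompact isCompact_Icc).mono_set Set.Ico_subset_Icc_self

theorem avg_eq (w : ℝ → ℝ) (J : ℤ × ℤ) :
    D.avg w J = (∫ x in D.interval J, w x) / D.length J := by
  rw [avg, setAverage_eq, volume_real_interval, smul_eq_mul, inv_mul_eq_div]

theorem avg_congr {w w' : ℝ → ℝ} {J : ℤ × ℤ} (h : Set.EqOn w w' (D.interval J)) :
    D.avg w J = D.avg w' J := by
  rw [avg_eq, avg_eq, setIntegral_congr_fun (D.measurableSet_interval J) h]

theorem avg_split {w : ℝ → ℝ} {J : ℤ × ℤ} (hw : IntegrableOn w (D.interval J)) :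
    D.avg w J = (D.avg w (leftHalf J) + D.avg w (rightHalf J)) / 2 := by
  have := D.length_pos J
  rw [avg_eq, avg_eq, avg_eq, length_leftHalf, length_rightHalf]
  conv_lhs => rw [D.interval_eq_union J, setIntegral_union (D.disjoint_halves J)
    (D.measurableSet_interval _) (hw.mono_set (D.leftHalf_subset J))
    (hw.mono_set (D.rightHalf_subset J))]
  field_simp

theorem avg_pos {w : ℝ → ℝ} (hw : IsWeight w) (J : ℤ × ℤ) : 0 < D.avg w J := by
  rw [avg_eq]
  refine div_pos ?_ (D.length_pos J)
  rw [setIntegral_pos_iff_support_of_nonneg_ae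
    (ae_restrict_of_ae (hw.2.mono fun x hx => hx.le)) (D.integrableOn_interval hw.1 J)]
  have : volume (Function.support w ∩ D.interval J) = volume (D.interval J) := by
    refine measure_congr ?_
    filter_upwards [hw.2] with x hx
    change (x ∈ Function.support w ∩ D.interval J) = (x ∈ D.interval J)
    simp [hx.ne']
  rw [this, volume_interval, ENNReal.ofReal_pos]
  exact D.length_pos J

/-- Integrate `(w - x)² / w ≥ 0` over `J`, with `x` the average of `w`. -/
theorem one_le_avg_mul_avg {w : ℝ → ℝ} (hw : IsWeight w) (hw' : IsWeight w⁻¹) (J : ℤ × ℤ) :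
    1 ≤ D.avg w J * D.avg w⁻¹ J := by
  have hx := D.avg_pos hw J
  have hl := D.length_pos J
  have h1 := D.integrableOn_interval hw.1 J
  have h2 := D.integrableOn_interval hw'.1 J
  set x := D.avg w J with hxdef
  have h : ∫ t in D.interval J, (2 * x) ≤ ∫ t in D.interval J, (w t + x ^ 2 * w⁻¹ t) := by
    refine setIntegral_mono_ae ?_ (h1.add (h2.const_mul _)) ?_
    · exact integrableOn_const (by rw [volume_interval]; exact ENNReal.ofReal_ne_top)
    · filter_upwards [hw.2] with t ht
      have : 0 ≤ (w t - x) ^ 2 / w t := by positivity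
      have e : (w t - x) ^ 2 / w t = w t + x ^ 2 * w⁻¹ t - 2 * x := by
        simp only [Pi.inv_apply]; field_simp; ring
      linarith
  rw [integral_add h1 (h2.const_mul _), integral_const_mul (x ^ 2), setIntegral_const,
    volume_real_interval, smul_eq_mul] at h
  have e1 : ∫ t in D.interval J, w t = x * D.length J := by
    rw [hxdef, avg_eq]; field_simp
  have e2 : ∫ t in D.interval J, w⁻¹ t = D.avg w⁻¹ J * D.length J := by
    rw [avg_eq]; field_simp
  rw [e1, e2] at h
  have : D.length J * x * 1 ≤ D.length J * x * (x * D.avg w⁻¹ J) := by linarith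
  exact le_of_mul_le_mul_left this (by positivity)

end DyadicLattice

/-! ### Upper bounds from supersolutions. -/

namespace DyadicLattice

variable (D : DyadicLattice)

theorem cSeq_nonneg {Φ : ℝ → ℝ} (hΦ : ∀ t : ℝ, 1 ≤ t → 0 ≤ Φ t) {w : ℝ → ℝ} {J : ℤ × ℤ}
    (h : 1 ≤ D.avg w J * D.avg w⁻¹ J) : 0 ≤ cSeq D Φ w J := by
  have := D.length_pos J
  have := hΦ _ h
  unfold cSeq
  positivity

theorem avg_mul_avg_le {w : ℝ → ℝ} {Q : ℝ} (hQ : 0 ≤ Q) (h : a2Char D w ≤ ENNReal.ofReal Q)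
    (J : ℤ × ℤ) : D.avg w J * D.avg w⁻¹ J ≤ Q :=
  (ENNReal.ofReal_le_ofReal_iff hQ).1 ((le_iSup (fun J : ℤ × ℤ =>
    ENNReal.ofReal (D.avg w J * D.avg w⁻¹ J)) J).trans h)

/-- The hypothesis `hb`, multiplied by `|J|`, says that `|J| b` pays for `c_J` and for the same
quantity on both halves. Iterating down the tree telescopes, and `b ≥ 0` discards what is left at
the bottom. -/
theorem upperK_le_of_supersolution {Φ b : ℝ → ℝ} {Q : ℝ} (hQ : 1 ≤ Q)
    (hΦ : ∀ t : ℝ, 1 ≤ t → 0 ≤ Φ t)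
    (hb0 : ∀ y ∈ Set.Icc 1 Q, 0 ≤ b y) (hbQ : ∀ y ∈ Set.Icc 1 Q, b y ≤ b Q)
    (hb : ∀ y u v : ℝ, |u| < 1 → |v| < 1 → y ∈ Set.Icc 1 Q →
      y * ((1 + u) * (1 + v)) ∈ Set.Icc 1 Q → y * ((1 - u) * (1 - v)) ∈ Set.Icc 1 Q →
      4 * Φ y * (u ^ 2 + v ^ 2) +
        (b (y * ((1 + u) * (1 + v))) + b (y * ((1 - u) * (1 - v)))) / 2 ≤ b y) :
    upperK D Φ Q ≤ ENNReal.ofReal (b Q) := by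
  refine iSup₂_le fun w ⟨⟨hw, hw', _⟩, hwQ⟩ => iSup_le fun I => ?_
  set prod : ℤ × ℤ → ℝ := fun J => D.avg w J * D.avg w⁻¹ J with hprod
  have hmem : ∀ J, prod J ∈ Set.Icc 1 Q := fun J =>
    ⟨D.one_le_avg_mul_avg hw hw' J, D.avg_mul_avg_le (by linarith) hwQ.le J⟩
  have hc : ∀ J, 0 ≤ cSeq D Φ w J := fun J => D.cSeq_nonneg hΦ (hmem J).1
  have step : ∀ J, cSeq D Φ w J + (D.length (leftHalf J) * b (prod (leftHalf J)) +
      D.length (rightHalf J) * b (prod (rightHalf J))) ≤ D.length J * b (prod J) := by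
    intro J
    have hX := D.avg_pos hw J
    have hY := D.avg_pos hw' J
    have hXl := D.avg_pos hw (leftHalf J)
    have hYl := D.avg_pos hw' (leftHalf J)
    have hXr := D.avg_pos hw (rightHalf J)
    have hYr := D.avg_pos hw' (rightHalf J)
    have hXs := D.avg_split (D.integrableOn_interval hw.1 J)
    have hYs := D.avg_split (D.integrableOn_interval hw'.1 J)
    have h0 := hmem J
    have hL := hmem (leftHalf J)
    have hR := hmem (rightHalf J)
    have hl := D.length_pos J
    simp only [hprod, cSeq, delta, length_leftHalf, length_rightHalf] at *
    generalize D.avg w J = X at *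
    generalize D.avg w⁻¹ J = Y at *
    generalize D.avg w (leftHalf J) = A at *
    generalize D.avg w⁻¹ (leftHalf J) = A' at *
    generalize D.avg w (rightHalf J) = B at *
    generalize D.avg w⁻¹ (rightHalf J) = B' at *
    have e1 : X * Y * ((1 + (A - B) / (2 * X)) * (1 + (A' - B') / (2 * Y))) = A * A' := by
      field_simp
      rw [hXs, hYs]; ring
    have e2 : X * Y * ((1 - (A - B) / (2 * X)) * (1 - (A' - B') / (2 * Y))) = B * B' := by
      field_simp
      rw [hXs, hYs]; ring
    have := hb (X * Y) ((A - B) / (2 * X)) ((A' - B') / (2 * Y))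
      (by rw [abs_div, abs_of_pos (by positivity : 0 < 2 * X), div_lt_one (by positivity), abs_lt]
          constructor <;> linarith)
      (by rw [abs_div, abs_of_pos (by positivity : 0 < 2 * Y), div_lt_one (by positivity), abs_lt]
          constructor <;> linarith) h0 (by rwa [e1]) (by rwa [e2])
    rw [e1, e2] at this
    have := mul_le_mul_of_nonneg_left this hl.le
    refine le_trans (le_of_eq ?_) this
    field_simp
    ring
  -- Induction on the number `n` of generations below `I` that meet the finite set `s`.
  have fin : ∀ (n : ℕ) (I : ℤ × ℤ) (s : Finset (ℤ × ℤ)),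
      (∀ J ∈ s, J ∈ D.subintervals I ∧ I.1 - J.1 < n) →
      ∑ J ∈ s, cSeq D Φ w J ≤ D.length I * b (prod I) := by
    intro n
    induction n with
    | zero =>
      intro I s hs
      have : s = ∅ := by
        refine Finset.eq_empty_of_forall_notMem fun J hJ => ?_
        have h1 := D.fst_le_of_mem (hs J hJ).1
        have h2 := (hs J hJ).2
        push_cast at h2
        omega
      rw [this, Finset.sum_empty]
      exact mul_nonneg (D.length_pos I).le (hb0 _ (hmem I))
    | succ n ih =>
      classical
      intro I s hs
      have hL := ih (leftHalf I) (s.filter (· ∈ D.subintervals (leftHalf I))) (by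
        intro J hJ
        rw [Finset.mem_filter] at hJ
        refine ⟨hJ.2, ?_⟩
        have := (hs J hJ.1).2
        simp only [leftHalf]
        push_cast at this
        linarith)
      have hR := ih (rightHalf I) (s.filter (· ∈ D.subintervals (rightHalf I))) (by
        intro J hJ
        rw [Finset.mem_filter] at hJ
        refine ⟨hJ.2, ?_⟩
        have := (hs J hJ.1).2
        simp only [rightHalf]
        push_cast at this
        linarith)
      refine le_trans ?_ (step I)
      refine le_trans ?_ (add_le_add_right (add_le_add hL hR) _)
      rw [Finset.sum_filter, Finset.sum_filter]
      have h1 : ∑ J ∈ s, (if J = I then cSeq D Φ w J else 0) ≤ cSeq D Φ w I := by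
        rw [Finset.sum_ite_eq']
        split_ifs
        · exact le_rfl
        · exact hc I
      refine le_trans ?_ (add_le_add_left h1 _)
      rw [← Finset.sum_add_distrib, ← Finset.sum_add_distrib]
      refine Finset.sum_le_sum fun J hJ => ?_
      have := (hs J hJ).1
      rw [subintervals_eq] at this
      have hcJ := hc J
      rcases this with h | h | h
      · rw [if_pos (Set.mem_singleton_iff.1 h)]
        have : 0 ≤ (if J ∈ D.subintervals (leftHalf I) then cSeq D Φ w J else 0) := by
          split_ifs <;> simp [hcJ]
        have : 0 ≤ (if J ∈ D.subintervals (rightHalf I) then cSeq D Φ w J else 0) := by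
          split_ifs <;> simp [hcJ]
        linarith
      · rw [if_pos h]
        have : 0 ≤ (if J = I then cSeq D Φ w J else 0) := by split_ifs <;> simp [hcJ]
        have : 0 ≤ (if J ∈ D.subintervals (rightHalf I) then cSeq D Φ w J else 0) := by
          split_ifs <;> simp [hcJ]
        linarith
      · rw [if_pos h]
        have : 0 ≤ (if J = I then cSeq D Φ w J else 0) := by split_ifs <;> simp [hcJ]
        have : 0 ≤ (if J ∈ D.subintervals (leftHalf I) then cSeq D Φ w J else 0) := by
          split_ifs <;> simp [hcJ]
        linarith
  have hI := D.length_pos I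
  refine ENNReal.div_le_of_le_mul ?_
  rw [← ENNReal.ofReal_mul (hb0 Q ⟨hQ, le_rfl⟩), ENNReal.tsum_eq_iSup_sum]
  refine iSup_le fun s => ?_
  rw [← ENNReal.ofReal_sum_of_nonneg (f := fun J : D.subintervals I => cSeq D Φ w J)
    fun J _ => hc J]
  refine ENNReal.ofReal_le_ofReal ?_
  -- The sum of all depths is a crude bound for each of them; the `+ 1` makes the inequality strict.
  have := fin ((∑ J ∈ s, (I.1 - (J : ℤ × ℤ).1)).toNat + 1) I (s.map (Function.Embedding.subtype _)) (by
    intro J hJ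
    simp only [Finset.mem_map, Function.Embedding.coe_subtype] at hJ
    obtain ⟨a, ha, rfl⟩ := hJ
    refine ⟨a.2, ?_⟩
    have : I.1 - (a : ℤ × ℤ).1 ≤ ∑ J ∈ s, (I.1 - (J : ℤ × ℤ).1) :=
      Finset.single_le_sum (f := fun J : D.subintervals I => I.1 - (J : ℤ × ℤ).1)
        (fun J _ => sub_nonneg.2 (D.fst_le_of_mem J.2)) ha
    push_cast
    have := Int.self_le_toNat (∑ J ∈ s, (I.1 - (J : ℤ × ℤ).1))
    linarith)
  rw [Finset.sum_map] at this
  refine this.trans ?_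
  rw [mul_comm]
  exact mul_le_mul_of_nonneg_right (hbQ _ (hmem I)) hI.le

end DyadicLattice

/-! ### Construction of weights by gluing. -/

theorem isWeight_of_bounds {w : ℝ → ℝ} {m M : ℝ} (hw : Measurable w) (hm : 0 < m)
    (h : ∀ t, w t ∈ Set.Icc m M) : IsWeight w := by
  refine ⟨(locallyIntegrable_const M).mono hw.aestronglyMeasurable (ae_of_all _ fun t => ?_),
    ae_of_all _ fun t => hm.trans_le (h t).1⟩
  rw [Real.norm_of_nonneg (hm.le.trans (h t).1)]
  exact (h t).2.trans (le_abs_self M)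

theorem isWeight_inv_of_bounds {w : ℝ → ℝ} {m M : ℝ} (hw : Measurable w) (hm : 0 < m)
    (h : ∀ t, w t ∈ Set.Icc m M) : IsWeight w⁻¹ := by
  have hM : 0 < M := hm.trans_le ((h 0).1.trans (h 0).2)
  refine isWeight_of_bounds (m := M⁻¹) (M := m⁻¹) hw.inv (inv_pos.2 hM) fun t => ⟨?_, ?_⟩
  · exact inv_anti₀ (hm.trans_le (h t).1) (h t).2
  · exact inv_anti₀ hm (h t).1

namespace DyadicLattice

variable (D : DyadicLattice)

/-- Over every dyadic interval there is a weight, bounded away from zero and infinity, with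
averages `x` of itself and `y` of its reciprocal, with characteristic at most `Q` below that
interval, and whose normalized sum is at least `v`. -/
def Attains (Φ : ℝ → ℝ) (Q x y v : ℝ) : Prop :=
  ∃ m M : ℝ, 0 < m ∧ ∀ I : ℤ × ℤ, ∃ w : ℝ → ℝ, Measurable w ∧ (∀ t, w t ∈ Set.Icc m M) ∧
    D.avg w I = x ∧ D.avg w⁻¹ I = y ∧
    (∀ J ∈ D.subintervals I, D.avg w J * D.avg w⁻¹ J ≤ Q) ∧
    ENNReal.ofReal (v * D.length I) ≤ ∑' J : D.subintervals I, ENNReal.ofReal (cSeq D Φ w J)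

variable {D} {Φ : ℝ → ℝ} {Q : ℝ}

theorem Attains.mono {x y v v' : ℝ} (h : D.Attains Φ Q x y v) (hv : v' ≤ v) :
    D.Attains Φ Q x y v' := by
  obtain ⟨m, M, hm, h⟩ := h
  refine ⟨m, M, hm, fun I => ?_⟩
  obtain ⟨w, h1, h2, h3, h4, h5, h6⟩ := h I
  exact ⟨w, h1, h2, h3, h4, h5, (ENNReal.ofReal_le_ofReal
    (mul_le_mul_of_nonneg_right hv (D.length_pos I).le)).trans h6⟩

theorem attains_const (hQ : 1 ≤ Q) {x : ℝ} (hx : 0 < x) : D.Attains Φ Q x x⁻¹ 0 := by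
  have avg_const : ∀ (c : ℝ) (J : ℤ × ℤ), D.avg (fun _ => c) J = c := by
    intro c J
    have := D.length_pos J
    rw [avg_eq, setIntegral_const, volume_real_interval, smul_eq_mul]
    field_simp
  have hinv : (fun _ : ℝ => x)⁻¹ = fun _ => x⁻¹ := rfl
  refine ⟨x, x, hx, fun I => ⟨fun _ => x, measurable_const, fun _ => ⟨le_rfl, le_rfl⟩,
    avg_const _ _, ?_, fun J _ => ?_, ?_⟩⟩
  · rw [hinv, avg_const]
  · rw [hinv, avg_const, avg_const, mul_inv_cancel₀ hx.ne']
    exact hQ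
  · simp

theorem cSeq_congr {w w' : ℝ → ℝ} {J : ℤ × ℤ} (h : Set.EqOn w w' (D.interval J)) :
    cSeq D Φ w J = cSeq D Φ w' J := by
  have h' : Set.EqOn w⁻¹ w'⁻¹ (D.interval J) := fun t ht => by simp [h ht]
  rw [cSeq, cSeq, delta, delta, delta, delta, D.avg_congr h, D.avg_congr h',
    D.avg_congr (h.mono (D.leftHalf_subset J)), D.avg_congr (h.mono (D.rightHalf_subset J)),
    D.avg_congr (h'.mono (D.leftHalf_subset J)), D.avg_congr (h'.mono (D.rightHalf_subset J))]

theorem tsum_congr_of_eqOn {w w' : ℝ → ℝ} {I : ℤ × ℤ} (h : Set.EqOn w w' (D.interval I)) :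
    ∑' J : D.subintervals I, ENNReal.ofReal (cSeq D Φ w J) =
      ∑' J : D.subintervals I, ENNReal.ofReal (cSeq D Φ w' J) :=
  tsum_congr fun J => by rw [cSeq_congr (h.mono J.2)]

/-- The reverse of a Bellman step: one weight on each half, and the sum over `I` gains exactly the
term of `I` itself. -/
theorem Attains.glue (hΦ : ∀ t : ℝ, 1 ≤ t → 0 ≤ Φ t) {x₁ y₁ v₁ x₂ y₂ v₂ x y : ℝ}
    (h₁ : D.Attains Φ Q x₁ y₁ v₁) (h₂ : D.Attains Φ Q x₂ y₂ v₂)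
    (hx : x = (x₁ + x₂) / 2) (hy : y = (y₁ + y₂) / 2) (hQ : x * y ≤ Q)
    (hv₁ : 0 ≤ v₁) (hv₂ : 0 ≤ v₂) :
    D.Attains Φ Q x y (Φ (x * y) * ((x₁ - x₂) ^ 2 / x ^ 2 + (y₁ - y₂) ^ 2 / y ^ 2) +
      (v₁ + v₂) / 2) := by
  obtain ⟨m₁, M₁, hm₁, h₁⟩ := h₁
  obtain ⟨m₂, M₂, hm₂, h₂⟩ := h₂
  refine ⟨min m₁ m₂, max M₁ M₂, lt_min hm₁ hm₂, fun I => ?_⟩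
  obtain ⟨w₁, meas₁, bd₁, ax₁, ay₁, q₁, s₁⟩ := h₁ (leftHalf I)
  obtain ⟨w₂, meas₂, bd₂, ax₂, ay₂, q₂, s₂⟩ := h₂ (rightHalf I)
  classical
  set w : ℝ → ℝ := (D.interval (leftHalf I)).piecewise w₁ w₂ with hw
  have meas : Measurable w := meas₁.piecewise (D.measurableSet_interval _) meas₂
  have bd : ∀ t, w t ∈ Set.Icc (min m₁ m₂) (max M₁ M₂) := by
    intro t
    by_cases ht : t ∈ D.interval (leftHalf I)
    · rw [hw, Set.piecewise_eq_of_mem _ _ _ ht]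
      exact ⟨(min_le_left _ _).trans (bd₁ t).1, (bd₁ t).2.trans (le_max_left _ _)⟩
    · rw [hw, Set.piecewise_eq_of_notMem _ _ _ ht]
      exact ⟨(min_le_right _ _).trans (bd₂ t).1, (bd₂ t).2.trans (le_max_right _ _)⟩
  have eL : Set.EqOn w w₁ (D.interval (leftHalf I)) := fun t ht =>
    Set.piecewise_eq_of_mem _ _ _ ht
  have eR : Set.EqOn w w₂ (D.interval (rightHalf I)) := fun t ht =>
    Set.piecewise_eq_of_notMem _ _ _ fun h => Set.disjoint_left.1 (D.disjoint_halves I) h ht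
  have eL' : Set.EqOn w⁻¹ w₁⁻¹ (D.interval (leftHalf I)) := fun t ht => by simp [eL ht]
  have eR' : Set.EqOn w⁻¹ w₂⁻¹ (D.interval (rightHalf I)) := fun t ht => by simp [eR ht]
  have wt := isWeight_of_bounds meas (lt_min hm₁ hm₂) bd
  have wt' := isWeight_inv_of_bounds meas (lt_min hm₁ hm₂) bd
  have bx : D.avg w I = x := by
    rw [D.avg_split (D.integrableOn_interval wt.1 I), D.avg_congr eL, D.avg_congr eR, ax₁, ax₂, hx]
  have bY : D.avg w⁻¹ I = y := by
    rw [D.avg_split (D.integrableOn_interval wt'.1 I), D.avg_congr eL', D.avg_congr eR', ay₁, ay₂,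
      hy]
  refine ⟨w, meas, bd, bx, bY, fun J hJ => ?_, ?_⟩
  · rw [subintervals_eq] at hJ
    rcases hJ with h | h | h
    · rw [Set.mem_singleton_iff.1 h, bx, bY]; exact hQ
    · rw [D.avg_congr (eL.mono h), D.avg_congr (eL'.mono h)]; exact q₁ J h
    · rw [D.avg_congr (eR.mono h), D.avg_congr (eR'.mono h)]; exact q₂ J h
  · rw [D.tsum_subintervals (fun J => ENNReal.ofReal (cSeq D Φ w J)), tsum_congr_of_eqOn eL,
      tsum_congr_of_eqOn eR]
    have hc := D.cSeq_nonneg hΦ (D.one_le_avg_mul_avg wt wt' I)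
    have hl := D.length_pos I
    refine le_trans (le_of_eq ?_) (add_le_add_right (add_le_add s₁ s₂) _)
    rw [length_leftHalf, length_rightHalf, ← ENNReal.ofReal_add (by positivity) (by positivity),
      ← ENNReal.ofReal_add hc (by positivity)]
    congr 1
    rw [cSeq, delta, delta, D.avg_congr eL, D.avg_congr eR, D.avg_congr eL', D.avg_congr eR', bx,
      bY, ax₁, ax₂, ay₁, ay₂]
    ring

/-- A weight with the two values `x(1 ± e)` suffices: its reciprocal has average `1 / (x(1 - e²))`,
which equals `y` for `e² = 1 - 1/(xy)`. -/
theorem attains_zero (hΦ : ∀ t : ℝ, 1 ≤ t → 0 ≤ Φ t) (hQ : 1 ≤ Q) {x y : ℝ} (hx : 0 < x)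
    (hy : 0 < y) (h1 : 1 ≤ x * y) (h : x * y ≤ Q) : D.Attains Φ Q x y 0 := by
  have hxy : 0 < x * y := mul_pos hx hy
  set e := √(1 - 1 / (x * y)) with he
  have h0 : 0 ≤ 1 - 1 / (x * y) := by
    rw [sub_nonneg, div_le_one hxy]; exact h1
  have e2 : e ^ 2 = 1 - 1 / (x * y) := Real.sq_sqrt h0
  have e0 : 0 ≤ e := Real.sqrt_nonneg _
  have e1 : e < 1 := by
    have : 0 < 1 / (x * y) := by positivity
    nlinarith
  have ha : 0 < x * (1 + e) := by positivity
  have hb : 0 < x * (1 - e) := mul_pos hx (by linarith)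
  refine (Attains.glue hΦ (attains_const hQ ha) (attains_const hQ hb) (by ring) ?_ h le_rfl
    le_rfl).mono ?_
  · have h1e : (1 + e) ≠ 0 := by positivity
    have h2e : (1 - e) ≠ 0 := by linarith
    have : (1 + e) * (1 - e) * (x * y) = 1 := by
      have : (1 + e) * (1 - e) = 1 / (x * y) := by linarith
      rw [this]; field_simp
    field_simp
    linarith
  · have := hΦ _ h1
    positivity

theorem mem_interval_zero_iff (k : ℤ) (t : ℝ) :
    t ∈ D.interval (0, k) ↔ ⌊(t - D.origin) / D.size⌋ = k := by
  have := D.size_pos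
  rw [Int.floor_eq_iff, le_div_iff₀ this, div_lt_iff₀ this]
  simp only [interval, length, zpow_zero, one_mul, Set.mem_Ico]
  constructor <;> rintro ⟨h1, h2⟩ <;> constructor <;> linarith

/-- Copies on all intervals of generation `0` tile the line. Larger intervals inherit the averages
`x` and `y`, so the characteristic is exactly `xy = Q`. The uniform bounds `m` and `M` keep the
tiled function and its reciprocal locally integrable. -/
theorem Attains.le_upperK {x y v : ℝ} (h : D.Attains Φ Q x y v) (hxy : x * y = Q) :
    ENNReal.ofReal v ≤ upperK D Φ Q := by
  obtain ⟨m, M, hm, h⟩ := h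
  choose W meas bd ax ay q s using fun k : ℤ => h (0, k)
  set w : ℝ → ℝ := fun t => W ⌊(t - D.origin) / D.size⌋ t with hw
  have hmeas : Measurable w := by
    have h1 : Measurable (Function.uncurry W) := measurable_from_prod_countable_right meas
    exact h1.comp ((Int.measurable_floor.comp
      ((measurable_id.sub_const _).div_const _)).prodMk measurable_id)
  have hbd : ∀ t, w t ∈ Set.Icc m M := fun t => bd _ t
  have wt := isWeight_of_bounds hmeas hm hbd
  have wt' := isWeight_inv_of_bounds hmeas hm hbd
  have e : ∀ k, Set.EqOn w (W k) (D.interval (0, k)) := fun k t ht => by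
    rw [hw]; dsimp only; rw [(mem_interval_zero_iff k t).1 ht]
  have e' : ∀ k, Set.EqOn w⁻¹ (W k)⁻¹ (D.interval (0, k)) := fun k t ht => by simp [e k ht]
  have big : ∀ (n : ℕ) (k : ℤ), D.avg w (n, k) = x ∧ D.avg w⁻¹ (n, k) = y := by
    intro n
    induction n with
    | zero => intro k; exact ⟨(D.avg_congr (e k)).trans (ax k), (D.avg_congr (e' k)).trans (ay k)⟩
    | succ n ih =>
      intro k
      rw [D.avg_split (D.integrableOn_interval wt.1 _),
        D.avg_split (D.integrableOn_interval wt'.1 _)]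
      have : ((n + 1 : ℕ) : ℤ) - 1 = n := by push_cast; ring
      simp only [leftHalf, rightHalf, this, ih]
      constructor <;> ring
  have hchar : a2Char D w = ENNReal.ofReal Q := by
    refine le_antisymm (iSup_le fun J => ENNReal.ofReal_le_ofReal ?_) ?_
    · obtain ⟨n, k⟩ := J
      rcases le_total 0 n with hn | hn
      · obtain ⟨n, rfl⟩ := Int.eq_ofNat_of_zero_le hn
        rw [(big n k).1, (big n k).2, hxy]
      · have hJ : (n, k) ∈ D.subintervals (0, k / 2 ^ (0 - n).toNat) := by
          rw [mem_subintervals, interval_subset_iff]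
          have h2 : (0 : ℤ) < 2 ^ (0 - n).toNat := by positivity
          exact ⟨hn, Int.ediv_mul_le _ h2.ne', Int.lt_ediv_add_one_mul_self k h2⟩
        rw [D.avg_congr ((e _).mono hJ), D.avg_congr ((e' _).mono hJ)]
        exact q _ _ hJ
    · have := le_iSup (fun J : ℤ × ℤ => ENNReal.ofReal (D.avg w J * D.avg w⁻¹ J)) (0, 0)
      have hb := big 0 0
      rw [Nat.cast_zero] at hb
      rwa [hb.1, hb.2, hxy] at this
  have hA2 : MemA2 D w := ⟨wt, wt', by rw [hchar]; exact ENNReal.ofReal_lt_top⟩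
  refine le_trans ?_ (le_iSup₂ (f := fun (w : ℝ → ℝ)
    (_ : MemA2 D w ∧ a2Char D w = ENNReal.ofReal Q) => carlesonNorm D (cSeq D Φ w)) w ⟨hA2, hchar⟩)
  refine le_trans ?_ (le_iSup (fun I : ℤ × ℤ =>
    (∑' J : D.subintervals I, ENNReal.ofReal (cSeq D Φ w J)) / ENNReal.ofReal (D.length I)) (0, 0))
  have hl := D.length_pos (0, 0)
  rw [ENNReal.le_div_iff_mul_le (Or.inl (by simpa using hl)) (Or.inl ENNReal.ofReal_ne_top),
    ← ENNReal.ofReal_mul' hl.le, tsum_congr_of_eqOn (e 0)]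
  exact s 0

end DyadicLattice

/-! ### Decreasing `Φ`. -/

theorem AntitoneOn.intervalIntegrable_div_id {Φ : ℝ → ℝ} (h : AntitoneOn Φ (Set.Ici 1)) {a b : ℝ}
    (ha : 1 ≤ a) (hb : 1 ≤ b) : IntervalIntegrable (fun y => Φ y / y) volume a b := by
  have hs : Set.uIcc a b ⊆ Set.Ici 1 := fun t ht => (le_inf ha hb).trans ht.1
  simp only [div_eq_mul_inv]
  refine (h.mono hs).intervalIntegrable.mul_continuousOn ?_
  exact continuousOn_id.inv₀ fun t ht => (lt_of_lt_of_le one_pos (hs ht)).ne'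

/-- The tangent inequality for a primitive that is concave in the variable `log y`; it holds for `z`
on either side of `y`. -/
theorem AntitoneOn.mul_log_le_integral_sub {Φ : ℝ → ℝ} (h : AntitoneOn Φ (Set.Ici 1)) {y z : ℝ}
    (hy : 1 ≤ y) (hz : 1 ≤ z) :
    Φ y * Real.log (y / z) ≤ (∫ t in (1 : ℝ)..y, Φ t / t) - ∫ t in (1 : ℝ)..z, Φ t / t := by
  rw [intervalIntegral.integral_interval_sub_left (h.intervalIntegrable_div_id le_rfl hy)
    (h.intervalIntegrable_div_id le_rfl hz)]
  have e : ∫ t in z..y, Φ y * t⁻¹ = Φ y * Real.log (y / z) := by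
    rw [intervalIntegral.integral_const_mul, integral_inv_of_pos (by linarith) (by linarith)]
  have hi : ∀ {a b : ℝ}, 1 ≤ a → 1 ≤ b → IntervalIntegrable (fun t => Φ y * t⁻¹) volume a b := by
    intro a b ha hb
    refine (intervalIntegral.intervalIntegrable_inv (fun t ht => ?_) continuousOn_id).const_mul _
    exact (lt_of_lt_of_le one_pos ((le_inf ha hb).trans ht.1)).ne'
  rw [← e]
  rcases le_total z y with hzy | hyz
  · refine intervalIntegral.integral_mono_on hzy (hi hz hy) (h.intervalIntegrable_div_id hz hy)
      fun t ht => ?_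
    have ht1 : 1 ≤ t := hz.trans ht.1
    rw [div_eq_mul_inv]
    exact mul_le_mul_of_nonneg_right (h ht1 hy ht.2) (by positivity)
  · rw [intervalIntegral.integral_symm y z, intervalIntegral.integral_symm y z, neg_le_neg_iff]
    refine intervalIntegral.integral_mono_on hyz (h.intervalIntegrable_div_id hy hz) (hi hy hz)
      fun t ht => ?_
    have ht1 : 1 ≤ t := hy.trans ht.1
    rw [div_eq_mul_inv]
    exact mul_le_mul_of_nonneg_right (h hy ht1 ht.1) (by positivity)

namespace DyadicLattice

variable {D : DyadicLattice} {Φ : ℝ → ℝ} {Q : ℝ}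

theorem upperK_le_of_antitoneOn (hΦ : ∀ t : ℝ, 1 ≤ t → 0 ≤ Φ t) (hQ : 1 ≤ Q)
    (h : AntitoneOn Φ (Set.Ici 1)) :
    upperK D Φ Q ≤ ENNReal.ofReal (8 * ∫ y in (1 : ℝ)..Q, Φ y / y) := by
  refine D.upperK_le_of_supersolution (b := fun y => 8 * ∫ t in (1 : ℝ)..y, Φ t / t) hQ hΦ ?_ ?_ ?_
  · intro y hy
    have := h.mul_log_le_integral_sub hy.1 le_rfl
    rw [intervalIntegral.integral_same, sub_zero, div_one] at this
    have := mul_nonneg (hΦ y hy.1) (Real.log_nonneg hy.1)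
    linarith
  · intro y hy
    have h1 := h.mul_log_le_integral_sub hQ hy.1
    have h2 : 1 ≤ Q / y := by rw [le_div_iff₀ (by linarith [hy.1])]; linarith [hy.2]
    have := mul_nonneg (hΦ Q hQ) (Real.log_nonneg h2)
    linarith
  · intro y u v hu hv hy hp hm
    have log_le : ∀ {u : ℝ}, |u| < 1 → Real.log (1 + u) + Real.log (1 - u) ≤ -u ^ 2 := by
      intro u hu
      rw [abs_lt] at hu
      rw [← Real.log_mul (by linarith) (by linarith)]
      refine (Real.log_le_sub_one_of_pos (by nlinarith)).trans (le_of_eq (by ring))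
    have lu := log_le hu
    have lv := log_le hv
    rw [abs_lt] at hu hv
    have hy0 : 0 < y := by linarith [hy.1]
    have h1 := h.mul_log_le_integral_sub hy.1 hp.1
    have h2 := h.mul_log_le_integral_sub hy.1 hm.1
    have e : ∀ {s t : ℝ}, 0 < s → 0 < t →
        Real.log (y / (y * (s * t))) = -(Real.log s + Real.log t) := by
      intro s t hs ht
      rw [← Real.log_mul hs.ne' ht.ne', ← Real.log_inv]
      congr 1
      field_simp
    rw [e (by linarith) (by linarith)] at h1 h2
    have := mul_le_mul_of_nonneg_left (add_le_add lu lv) (hΦ y hy.1)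
    linarith

/-- Scaling the averages by `(1 ± e, 1 ∓ e)` with `e² = 1 - 1/q` lowers the product from `q^(k+1)`
to `q^k` on both halves at once, and each such split earns `8 Φ(q^(k+1)) e²`. -/
theorem attains_of_geometric (hΦ : ∀ t : ℝ, 1 ≤ t → 0 ≤ Φ t) {q : ℝ} (hq : 1 ≤ q) {N : ℕ}
    (hQN : q ^ N ≤ Q) (k : ℕ) (hk : k ≤ N) {x y : ℝ} (hx : 0 < x) (hy : 0 < y)
    (hxy : x * y = q ^ k) :
    D.Attains Φ Q x y (8 * ∑ j ∈ Finset.range k, Φ (q ^ (j + 1)) * (1 - 1 / q)) := by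
  have hQ : ∀ {k}, k ≤ N → q ^ k ≤ Q := fun hk => (pow_le_pow_right₀ hq hk).trans hQN
  have hq0 : 0 < q := by linarith
  have hε : 0 ≤ 1 - 1 / q := by rw [sub_nonneg, div_le_one hq0]; exact hq
  induction k generalizing x y with
  | zero =>
    rw [Finset.sum_range_zero, mul_zero]
    rw [pow_zero] at hxy
    exact attains_zero hΦ ((one_le_pow₀ hq).trans hQN) hx hy hxy.ge
      (hxy.trans_le ((one_le_pow₀ hq).trans hQN))
  | succ k ih =>
    set e := √(1 - 1 / q)
    have e2 : e ^ 2 = 1 - 1 / q := Real.sq_sqrt hε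
    have e0 : 0 ≤ e := Real.sqrt_nonneg _
    have e1 : e < 1 := by
      have : 0 < 1 / q := by positivity
      nlinarith
    have em : 0 < 1 - e := by linarith
    have key : x * y * (1 - e ^ 2) = q ^ k := by
      rw [e2, hxy, pow_succ]; field_simp; ring
    have hs : 0 ≤ 8 * ∑ j ∈ Finset.range k, Φ (q ^ (j + 1)) * (1 - 1 / q) :=
      mul_nonneg (by norm_num) (Finset.sum_nonneg fun j _ =>
        mul_nonneg (hΦ _ (one_le_pow₀ hq)) hε)
    have h1 := ih (by omega) (x := x * (1 + e)) (y := y * (1 - e)) (by positivity)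
      (by positivity) (by rw [← key]; ring)
    have h2 := ih (by omega) (x := x * (1 - e)) (y := y * (1 + e)) (by positivity)
      (by positivity) (by rw [← key]; ring)
    refine (Attains.glue hΦ h1 h2 (by ring) (by ring) (hxy.trans_le (hQ hk)) hs hs).mono
      (le_of_eq ?_)
    rw [Finset.sum_range_succ, hxy]
    generalize ∑ j ∈ Finset.range k, Φ (q ^ (j + 1)) * (1 - 1 / q) = T
    rw [← e2]
    field_simp
    ring

theorem le_upperK_of_antitoneOn (hΦ : ∀ t : ℝ, 1 ≤ t → 0 ≤ Φ t) (hQ : 1 ≤ Q)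
    (h : AntitoneOn Φ (Set.Ici 1)) :
    ENNReal.ofReal (8 * ∫ y in (1 : ℝ)..Q, Φ y / y) ≤ upperK D Φ Q := by
  set I := ∫ y in (1 : ℝ)..Q, Φ y / y with hI
  have hQ0 : 0 < Q := by linarith
  -- With `q = Q^(1/(N+1))` the reward is a right-endpoint Riemann sum on a geometric grid. Shifting
  -- it to left endpoints, which dominate the integral, costs `Φ 1 * (q - 1)`, and passing from `q -
  -- 1` to `1 - 1/q` costs a factor `q`; both losses vanish as `q → 1`.
  have key : ∀ N : ℕ, ENNReal.ofReal (8 * ((I - Φ 1 * (Q ^ (1 / ((N : ℝ) + 1)) - 1)) /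
      Q ^ (1 / ((N : ℝ) + 1)))) ≤ upperK D Φ Q := by
    intro N
    set q := Q ^ (1 / ((N : ℝ) + 1)) with hqdef
    have hq : 1 ≤ q := Real.one_le_rpow hQ (by positivity)
    have hq0 : 0 < q := by linarith
    have hqN : q ^ (N + 1) = Q := by
      rw [hqdef, ← Real.rpow_natCast, ← Real.rpow_mul hQ0.le]
      push_cast
      rw [one_div_mul_cancel (by positivity), Real.rpow_one]
    have att := attains_of_geometric (D := D) hΦ hq hqN.le (N + 1) le_rfl (x := 1) (y := Q) one_pos
      hQ0 (by rw [hqN, one_mul])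
    refine le_trans (ENNReal.ofReal_le_ofReal ?_) (att.le_upperK (one_mul Q))
    refine mul_le_mul_of_nonneg_left ?_ (by norm_num)
    rw [div_le_iff₀ hq0, sub_le_iff_le_add]
    have piece : ∀ k : ℕ, ∫ y in q ^ k..q ^ (k + 1), Φ y / y ≤ Φ (q ^ k) * (q - 1) := by
      intro k
      have hk : 1 ≤ q ^ k := one_le_pow₀ hq
      have hk' : q ^ k ≤ q ^ (k + 1) := pow_le_pow_right₀ hq (Nat.le_succ k)
      have := intervalIntegral.integral_mono_on hk'
        (h.intervalIntegrable_div_id hk (hk.trans hk'))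
        (intervalIntegrable_const (c := Φ (q ^ k) / q ^ k)) fun t ht => by
          have : 1 ≤ t := hk.trans ht.1
          exact div_le_div₀ (hΦ _ hk) (h hk this ht.1) (by positivity) ht.1
      refine this.trans (le_of_eq ?_)
      rw [intervalIntegral.integral_const, smul_eq_mul, pow_succ]
      field_simp
    have total : ∑ k ∈ Finset.range (N + 1), ∫ y in q ^ k..q ^ (k + 1), Φ y / y = I := by
      rw [intervalIntegral.sum_integral_adjacent_intervals (a := fun k => q ^ k), pow_zero, hqN]
      exact fun k _ => h.intervalIntegrable_div_id (one_le_pow₀ hq) (one_le_pow₀ hq)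
    have last : 0 ≤ Φ (q ^ (N + 1)) * (q - 1) :=
      mul_nonneg (hΦ _ (one_le_pow₀ hq)) (by linarith)
    calc I ≤ ∑ k ∈ Finset.range (N + 1), Φ (q ^ k) * (q - 1) :=
          total.symm.le.trans (Finset.sum_le_sum fun k _ => piece k)
      _ ≤ ∑ k ∈ Finset.range (N + 2), Φ (q ^ k) * (q - 1) := by
          rw [Finset.sum_range_succ _ (N + 1)]; linarith
      _ = _ := by
          rw [Finset.sum_range_succ', pow_zero, Finset.sum_mul]
          congr 1
          refine Finset.sum_congr rfl fun k _ => ?_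
          field_simp
  have lim0 : Filter.Tendsto (fun N : ℕ => Q ^ (1 / ((N : ℝ) + 1))) Filter.atTop (nhds 1) := by
    have := (Real.continuous_const_rpow hQ0.ne').continuousAt.tendsto.comp
      tendsto_one_div_add_atTop_nhds_zero_nat
    rwa [Real.rpow_zero] at this
  have lim := (((lim0.sub_const 1).const_mul (Φ 1)).const_sub I).div lim0 one_ne_zero
  rw [sub_self, mul_zero, sub_zero, div_one] at lim
  exact le_of_tendsto (ENNReal.tendsto_ofReal (lim.const_mul 8)) (Filter.Eventually.of_forall key)

end DyadicLattice

/-! ### Convex `h`: the Green potential as a supersolution. -/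

/-- Symmetrization of an integral about the midpoint of a convex function. -/
theorem ConvexOn.two_mul_mul_le_integral {g : ℝ → ℝ} {c : ℝ} (hg : ConvexOn ℝ (Set.Ici c) g)
    (hi : ∀ a b : ℝ, IntervalIntegrable g volume a b) {r δ : ℝ} (hδ : 0 ≤ δ) (hr : c ≤ r - δ) :
    2 * δ * g r ≤ ∫ t in (r - δ)..(r + δ), g t := by
  have e : ∫ t in (r - δ)..(r + δ), g (2 * r - t) = ∫ t in (r - δ)..(r + δ), g t := by
    rw [intervalIntegral.integral_comp_sub_left]
    congr 1 <;> ring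
  have hi' : IntervalIntegrable (fun t => g (2 * r - t)) volume (r - δ) (r + δ) := by
    have := (hi (r + δ) (r - δ)).comp_sub_left (2 * r)
    rwa [show 2 * r - (r + δ) = r - δ by ring, show 2 * r - (r - δ) = r + δ by ring] at this
  have h : ∫ t in (r - δ)..(r + δ), 2 * g r ≤
      ∫ t in (r - δ)..(r + δ), (g t + g (2 * r - t)) := by
    refine intervalIntegral.integral_mono_on (by linarith) intervalIntegrable_const
      ((hi _ _).add hi') fun t ht => ?_
    have h1 : t ∈ Set.Ici c := hr.trans ht.1
    have h2 : 2 * r - t ∈ Set.Ici c := by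
      have := ht.2
      rw [Set.mem_Ici]; linarith
    have := hg.2 h1 h2 (by norm_num : (0 : ℝ) ≤ 1 / 2) (by norm_num : (0 : ℝ) ≤ 1 / 2)
      (by norm_num)
    simp only [smul_eq_mul] at this
    rw [show 1 / 2 * t + 1 / 2 * (2 * r - t) = r by ring] at this
    linarith
  rw [intervalIntegral.integral_add (hi _ _) hi', e, intervalIntegral.integral_const,
    smul_eq_mul] at h
  linarith

section Concave

variable {g : ℝ → ℝ} {S : ℝ}

/-- The derivative of `greenPotential`. -/
noncomputable def greenSlope (g : ℝ → ℝ) (S t : ℝ) : ℝ := 16 * (S * g S + ∫ v in t..S, g v)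

/-- The solution of `F'' = -16 g`, `F 1 = 0`, `F' S = 16 S g(S)`. -/
noncomputable def greenPotential (g : ℝ → ℝ) (S s : ℝ) : ℝ := ∫ t in (1 : ℝ)..s, greenSlope g S t

theorem greenSlope_sub (hi : ∀ a b : ℝ, IntervalIntegrable g volume a b) (s t : ℝ) :
    greenSlope g S s - greenSlope g S t = 16 * ∫ v in s..t, g v := by
  rw [greenSlope, greenSlope, ← intervalIntegral.integral_add_adjacent_intervals (hi s t) (hi t S)]
  ring

theorem continuous_greenSlope (hi : ∀ a b : ℝ, IntervalIntegrable g volume a b) :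
    Continuous (greenSlope g S) := by
  have h := intervalIntegral.continuous_primitive hi S
  have e : greenSlope g S = fun t => 16 * (S * g S - ∫ v in S..t, g v) := by
    ext t
    rw [greenSlope, intervalIntegral.integral_symm]
    ring
  rw [e]
  fun_prop

theorem antitone_greenSlope (hi : ∀ a b : ℝ, IntervalIntegrable g volume a b) (h0 : ∀ t, 0 ≤ g t) :
    Antitone (greenSlope g S) := by
  intro s t hst
  have h1 := greenSlope_sub (S := S) hi s t
  have h2 := intervalIntegral.integral_nonneg (μ := volume) hst fun u _ => h0 u
  linarith

theorem hasDerivAt_greenPotential (hi : ∀ a b : ℝ, IntervalIntegrable g volume a b) (s : ℝ) :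
    HasDerivAt (greenPotential g S) (greenSlope g S s) s :=
  intervalIntegral.integral_hasDerivAt_right ((continuous_greenSlope hi).intervalIntegrable _ _)
    ((continuous_greenSlope hi).stronglyMeasurableAtFilter _ _) (continuous_greenSlope hi).continuousAt

theorem mul_greenSlope_le (hi : ∀ a b : ℝ, IntervalIntegrable g volume a b) (h0 : ∀ t, 0 ≤ g t)
    {p q : ℝ} (hpq : p ≤ q) :
    (q - p) * greenSlope g S q ≤ greenPotential g S q - greenPotential g S p := by
  have hc := continuous_greenSlope (S := S) hi
  rw [greenPotential, greenPotential, intervalIntegral.integral_interval_sub_left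
    (hc.intervalIntegrable _ _) (hc.intervalIntegrable _ _), ← smul_eq_mul,
    ← intervalIntegral.integral_const]
  exact intervalIntegral.integral_mono_on hpq intervalIntegrable_const (hc.intervalIntegrable _ _)
    fun t ht => antitone_greenSlope hi h0 ht.2

/-- Since `t² g(t)` increases, `g(t) ≥ r² g(r) / t²` on `[r, S]`. The integral is then at least `r²
g(r)(1/r - 1/S)`, and the boundary term `S g(S) ≥ r² g(r)/S` restores exactly what is missing. -/
theorem mul_le_greenSlope (hi : ∀ a b : ℝ, IntervalIntegrable g volume a b)
    (hm : ∀ s t, 1 ≤ s → s ≤ t → s ^ 2 * g s ≤ t ^ 2 * g t) {r : ℝ} (hr : 1 ≤ r) (hrS : r ≤ S) :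
    16 * (r * g r) ≤ greenSlope g S r := by
  have hr0 : 0 < r := by linarith
  have hS0 : 0 < S := by linarith
  have pos : ∀ t ∈ Set.uIcc r S, t ≠ 0 := fun t ht => by
    rw [Set.uIcc_of_le hrS] at ht
    exact (hr0.trans_le ht.1).ne'
  have hii : IntervalIntegrable (fun t : ℝ => (t ^ 2)⁻¹) volume r S :=
    intervalIntegral.intervalIntegrable_inv (fun t ht => pow_ne_zero 2 (pos t ht))
      (continuousOn_id.pow 2)
  have e : ∫ t in r..S, r ^ 2 * g r * (t ^ 2)⁻¹ = r ^ 2 * g r * (r⁻¹ - S⁻¹) := by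
    rw [intervalIntegral.integral_const_mul]
    congr 1
    rw [intervalIntegral.integral_eq_sub_of_hasDerivAt (f := fun t => -t⁻¹) _ hii]
    · ring
    · intro t ht
      have := (hasDerivAt_inv (pos t ht)).neg
      rwa [neg_neg] at this
  have h : ∫ t in r..S, r ^ 2 * g r * (t ^ 2)⁻¹ ≤ ∫ t in r..S, g t := by
    refine intervalIntegral.integral_mono_on hrS (hii.const_mul _) (hi _ _) fun t ht => ?_
    have ht0 : 0 < t := hr0.trans_le ht.1
    rw [← div_eq_mul_inv, div_le_iff₀ (by positivity)]
    linarith [hm r t hr ht.1]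
  have hS : r ^ 2 * g r * S⁻¹ ≤ S * g S := by
    rw [← div_eq_mul_inv, div_le_iff₀ hS0]
    linarith [hm r S hr hrS]
  rw [e] at h
  have e2 : r ^ 2 * g r * r⁻¹ = r * g r := by field_simp
  unfold greenSlope
  linarith

/-- The derivative in `δ` of the right side is `16 ∫ g` over `[r - δ, r + δ]`, at least `32 δ g(r)`
by convexity. -/
theorem greenPotential_second_difference (hi : ∀ a b : ℝ, IntervalIntegrable g volume a b)
    (hg : ConvexOn ℝ (Set.Ici 1) g) {r δ : ℝ} (hδ : 0 ≤ δ) (hr : 1 ≤ r - δ) :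
    16 * δ ^ 2 * g r ≤
      2 * greenPotential g S r - greenPotential g S (r - δ) - greenPotential g S (r + δ) := by
  have hd : ∀ d : ℝ, HasDerivAt (fun d => 2 * greenPotential g S r - greenPotential g S (r - d) -
      greenPotential g S (r + d) - 16 * g r * d ^ 2)
      (greenSlope g S (r - d) - greenSlope g S (r + d) - 32 * d * g r) d := by
    intro d
    have h1 : HasDerivAt (fun d => greenPotential g S (r - d)) (greenSlope g S (r - d) * -1) d :=
      (hasDerivAt_greenPotential (S := S) hi (r - d)).comp d ((hasDerivAt_id d).const_sub r)
    have h2 : HasDerivAt (fun d => greenPotential g S (r + d)) (greenSlope g S (r + d) * 1) d :=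
      (hasDerivAt_greenPotential (S := S) hi (r + d)).comp d ((hasDerivAt_id d).const_add r)
    have h3 : HasDerivAt (fun d : ℝ => d ^ 2) (2 * d) d := by simpa using hasDerivAt_pow 2 d
    exact (((h1.const_sub (2 * greenPotential g S r)).sub h2).sub
      (h3.const_mul (16 * g r))).congr_deriv (by ring)
  have mono : MonotoneOn (fun d => 2 * greenPotential g S r - greenPotential g S (r - d) -
      greenPotential g S (r + d) - 16 * g r * d ^ 2) (Set.Icc 0 δ) := by
    refine monotoneOn_of_deriv_nonneg (convex_Icc 0 δ)
      (fun d _ => (hd d).continuousAt.continuousWithinAt)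
      (fun d _ => (hd d).differentiableAt.differentiableWithinAt) fun d hd' => ?_
    rw [interior_Icc] at hd'
    rw [(hd d).deriv, greenSlope_sub hi]
    have := hg.two_mul_mul_le_integral hi hd'.1.le (r := r) (by linarith [hd'.2])
    linarith
  have := mono (Set.left_mem_Icc.2 hδ) (Set.right_mem_Icc.2 hδ) hδ
  simp only [sub_zero, add_zero] at this
  linarith

theorem greenPotential_supersolution (hi : ∀ a b : ℝ, IntervalIntegrable g volume a b)
    (h0 : ∀ t, 0 ≤ g t) (hg : ConvexOn ℝ (Set.Ici 1) g)
    (hm : ∀ s t, 1 ≤ s → s ≤ t → s ^ 2 * g s ≤ t ^ 2 * g t) {p q r : ℝ} (hp : 1 ≤ p)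
    (hpq : p ≤ q) (hr : 1 ≤ r) (hq : q ≤ S) (hrS : r ≤ S) (h : p + q ≤ 2 * r) :
    8 * g r * (r ^ 2 - p * q) + (greenPotential g S p + greenPotential g S q) / 2 ≤
      greenPotential g S r := by
  have hgr := h0 r
  have base := mul_le_greenSlope hi hm hr hrS
  rcases le_total q r with hqr | hrq
  -- Both points lie left of `r`, so the slope at `r` suffices: `r(2r - p - q) - (r² - pq) = (r -
  -- p)(r - q) ≥ 0`.
  · have h1 := mul_greenSlope_le (S := S) hi h0 (hpq.trans hqr)
    have h2 := mul_greenSlope_le (S := S) hi h0 hqr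
    have h3 := mul_le_mul_of_nonneg_left base (sub_nonneg.2 (hpq.trans hqr))
    have h4 := mul_le_mul_of_nonneg_left base (sub_nonneg.2 hqr)
    have h5 := mul_nonneg hgr (mul_nonneg (sub_nonneg.2 (hpq.trans hqr)) (sub_nonneg.2 hqr))
    linarith
  -- Compare `p` with the reflection `2r - q` of `q`: `r² - pq = (q - r)² + q(2r - q - p)`. The
  -- second difference pays for the square, and the slope at `2r - q` for the rest.
  · have hp' : p ≤ 2 * r - q := by linarith
    have slope : 16 * (q * g r) ≤ greenSlope g S (2 * r - q) := by
      rcases le_total (g r) (g q) with hle | hge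
      · have h1 := mul_le_greenSlope hi hm (hr.trans hrq) hq
        have h2 := antitone_greenSlope (S := S) hi h0 (show 2 * r - q ≤ q by linarith)
        have h3 := mul_le_mul_of_nonneg_left hle (show 0 ≤ q by linarith)
        linarith
      -- If `g` does not increase from `r` to `q`, convexity forces `g ≥ g r` on `[2r - q, r]`. This
      -- adds `16 (q - r) g(r)` to the bound `16 r g(r)` for the slope at `r`.
      · have h1 := greenSlope_sub (S := S) hi (2 * r - q) r
        have h2 : ∫ t in (2 * r - q)..r, g r ≤ ∫ t in (2 * r - q)..r, g t := by
          refine intervalIntegral.integral_mono_on (by linarith) intervalIntegrable_const (hi _ _)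
            fun t ht => ?_
          rcases ht.2.eq_or_lt with rfl | htr
          · exact le_rfl
          rcases hrq.eq_or_lt with rfl | hrq
          · linarith [ht.1]
          by_contra! hlt
          have hline := hg.lt_right_of_left_lt (x := t) (y := q) (z := r)
            (by rw [Set.mem_Ici]; linarith [ht.1]) (by rw [Set.mem_Ici]; linarith)
            (by rw [openSegment_eq_Ioo (by linarith)]; exact ⟨htr, hrq⟩) hlt
          linarith
        rw [intervalIntegral.integral_const, smul_eq_mul] at h2
        linarith
    have h1 := mul_greenSlope_le (S := S) hi h0 hp'
    have h2 := mul_le_mul_of_nonneg_left slope (sub_nonneg.2 hp')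
    have h3 := greenPotential_second_difference (S := S) hi hg (r := r) (δ := q - r) (by linarith)
      (by linarith)
    rw [show r - (q - r) = 2 * r - q by ring, show r + (q - r) = q by ring] at h3
    linarith

end Concave

/-- Integration by parts against `t - 1`. Continuity is needed only on the open half-line, where
convexity provides it. -/
theorem greenPotential_self {g : ℝ → ℝ} {S : ℝ} (hS : 1 ≤ S)
    (hi : ∀ a b : ℝ, IntervalIntegrable g volume a b) (hc : ContinuousOn g (Set.Ioi 1)) :
    greenPotential g S S = 16 * (S - 1) * (S * g S) + 16 * ∫ t in (1 : ℝ)..S, (t - 1) * g t := by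
  have hcont : Continuous fun t => ∫ v in t..S, g v := by
    simp_rw [intervalIntegral.integral_symm S]
    exact (intervalIntegral.continuous_primitive hi S).neg
  have parts := intervalIntegral.integral_mul_deriv_eq_deriv_mul_of_hasDerivAt
    (u := fun t => ∫ v in t..S, g v) (v := fun t => t - 1) (u' := fun t => -g t) (v' := fun _ => 1)
    (a := 1) (b := S) hcont.continuousOn (by fun_prop)
    (fun t ht => by
      rw [min_eq_left hS] at ht
      exact intervalIntegral.integral_hasDerivAt_left (hi _ _)
        (hc.stronglyMeasurableAtFilter isOpen_Ioi t ht.1)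
        (hc.continuousAt (isOpen_Ioi.mem_nhds ht.1)))
    (fun t _ => (hasDerivAt_id t).sub_const 1) (hi _ _).neg intervalIntegrable_const
  simp only [mul_one, intervalIntegral.integral_same, zero_mul, sub_self, mul_zero, neg_mul,
    intervalIntegral.integral_neg, zero_sub, neg_neg] at parts
  have e : ∀ t, greenSlope g S t = 16 * (S * g S) + 16 * ∫ v in t..S, g v := fun t => by
    rw [greenSlope]; ring
  simp only [greenPotential, e]
  rw [intervalIntegral.integral_add intervalIntegrable_const
    ((hcont.intervalIntegrable _ _).const_mul _), intervalIntegral.integral_const,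
    intervalIntegral.integral_const_mul, parts, smul_eq_mul]
  simp_rw [mul_comm (g _)]
  ring

namespace DyadicLattice

variable {D : DyadicLattice} {Φ Ψ : ℝ → ℝ} {Q : ℝ}

theorem upperK_mono (h : ∀ t : ℝ, 1 ≤ t → Φ t ≤ Ψ t) : upperK D Φ Q ≤ upperK D Ψ Q := by
  refine iSup₂_mono fun w hw => iSup_mono fun I => ENNReal.div_le_div_right
    (ENNReal.tsum_le_tsum fun J => ENNReal.ofReal_le_ofReal ?_) _
  have := D.length_pos J
  exact mul_le_mul_of_nonneg_right (mul_le_mul_of_nonneg_left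
    (h _ (D.one_le_avg_mul_avg hw.1.1 hw.1.2.1 J)) this.le) (by positivity)

theorem upperK_le_of_convexOn (hΦ : ∀ t : ℝ, 1 ≤ t → 0 ≤ Φ t) (hQ : 1 ≤ Q)
    (hm : MonotoneOn Φ (Set.Ici 1)) (hc : ConvexOn ℝ (Set.Ici 1) (hFun Φ)) :
    upperK D Φ Q ≤ ENNReal.ofReal (16 * (√Q - 1) * (√Q * hFun Φ √Q) +
      16 * ∫ t in (1 : ℝ)..√Q, (t - 1) * hFun Φ t) := by
  -- Extending `h` by the constant `h 1` to the left of `1` makes the integrability and sign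
  -- conditions global.
  set g : ℝ → ℝ := fun t => hFun Φ (max 1 t) with hg
  have hge : ∀ t, 1 ≤ t → g t = hFun Φ t := fun t ht => by rw [hg]; dsimp only; rw [max_eq_right ht]
  have one_le_sq : ∀ t : ℝ, 1 ≤ t → 1 ≤ t ^ 2 := fun t ht => one_le_pow₀ ht
  have sq_g : ∀ t, 1 ≤ t → t ^ 2 * g t = Φ (t ^ 2) := fun t ht => by
    have : t ≠ 0 := by positivity
    rw [hge t ht, hFun]; field_simp
  have h0 : ∀ t, 0 ≤ g t := fun t =>
    div_nonneg (hΦ _ (one_le_sq _ (le_max_left _ _))) (sq_nonneg _)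
  have hi : ∀ a b : ℝ, IntervalIntegrable g volume a b := by
    intro a b
    have h1 : Monotone fun t : ℝ => Φ (max 1 t ^ 2) := fun s t hst =>
      hm (one_le_sq _ (le_max_left _ _)) (one_le_sq _ (le_max_left _ _))
        (pow_le_pow_left₀ (by positivity) (max_le_max_left 1 hst) 2)
    have h2 : Continuous fun t : ℝ => (max 1 t ^ 2)⁻¹ :=
      (by fun_prop : Continuous fun t : ℝ => max 1 t ^ 2).inv₀ fun t => by positivity
    exact h1.intervalIntegrable.mul_continuousOn h2.continuousOn
  have hcg : ConvexOn ℝ (Set.Ici 1) g := hc.congr fun t ht => (hge t ht).symm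
  have hmg : ∀ s t, 1 ≤ s → s ≤ t → s ^ 2 * g s ≤ t ^ 2 * g t := by
    intro s t hs hst
    rw [sq_g s hs, sq_g t (hs.trans hst)]
    exact hm (one_le_sq s hs) (one_le_sq t (hs.trans hst)) (pow_le_pow_left₀ (by linarith) hst 2)
  have hcont : ContinuousOn g (Set.Ioi 1) := by
    have := (hcg.subset Set.Ioi_subset_Ici_self (convex_Ioi 1)).continuousOn isOpen_Ioi
    exact this
  have hS : 1 ≤ √Q := Real.one_le_sqrt.2 hQ
  have sqrt_mem : ∀ y ∈ Set.Icc 1 Q, 1 ≤ √y ∧ √y ≤ √Q := fun y hy =>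
    ⟨Real.one_le_sqrt.2 hy.1, Real.sqrt_le_sqrt hy.2⟩
  have slope_nonneg : ∀ s, s ≤ √Q → 0 ≤ greenSlope g √Q s := fun s hs => by
    have := intervalIntegral.integral_nonneg (μ := volume) hs fun u _ => h0 u
    have := h0 √Q
    unfold greenSlope
    positivity
  have pot_mono : ∀ s t, s ≤ t → t ≤ √Q → greenPotential g √Q s ≤ greenPotential g √Q t := by
    intro s t hst ht
    have h1 := mul_greenSlope_le (S := √Q) hi h0 hst
    have h2 := mul_nonneg (sub_nonneg.2 hst) (slope_nonneg t ht)
    linarith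
  have hval : greenPotential g √Q √Q = 16 * (√Q - 1) * (√Q * hFun Φ √Q) +
      16 * ∫ t in (1 : ℝ)..√Q, (t - 1) * hFun Φ t := by
    rw [greenPotential_self hS hi hcont, hge _ hS]
    congr 2
    refine intervalIntegral.integral_congr fun t ht => ?_
    rw [Set.uIcc_of_le hS] at ht
    simp only [hge t ht.1]
  rw [← hval]
  refine D.upperK_le_of_supersolution (b := fun y => greenPotential g √Q √y) hQ hΦ ?_ ?_ ?_
  · intro y hy
    have := pot_mono 1 √y (sqrt_mem y hy).1 (sqrt_mem y hy).2
    rwa [greenPotential, intervalIntegral.integral_same] at this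
  · exact fun y hy => pot_mono _ _ (sqrt_mem y hy).2 le_rfl
  · intro y u v hu hv hy hp hm'
    have hy0 : 0 < y := by linarith [hy.1]
    rw [abs_lt] at hu hv
    set r := √y with hr
    set q := √(y * ((1 + u) * (1 + v))) with hq
    set p := √(y * ((1 - u) * (1 - v))) with hpdef
    have r2 : r ^ 2 = y := Real.sq_sqrt hy0.le
    have q2 : q ^ 2 = y * ((1 + u) * (1 + v)) := Real.sq_sqrt (by linarith [hp.1])
    have p2 : p ^ 2 = y * ((1 - u) * (1 - v)) := Real.sq_sqrt (by linarith [hm'.1])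
    have hr1 := sqrt_mem y hy
    have hq1 := sqrt_mem _ hp
    have hp1 := sqrt_mem _ hm'
    rw [← hr] at hr1
    rw [← hq] at hq1
    rw [← hpdef] at hp1
    have u1 : u ^ 2 ≤ 1 := by nlinarith
    have v1 : v ^ 2 ≤ 1 := by nlinarith
    -- AM-GM for `1 - u²` and `1 - v²`.
    have hpq : p * q ≤ y * (1 - (u ^ 2 + v ^ 2) / 2) := by
      refine le_of_sq_le_sq ?_ (mul_nonneg hy0.le (by linarith))
      have e : (p * q) ^ 2 = y ^ 2 * ((1 - u ^ 2) * (1 - v ^ 2)) := by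
        rw [mul_pow, p2, q2]; ring
      rw [e, mul_pow]
      refine mul_le_mul_of_nonneg_left ?_ (sq_nonneg y)
      linarith [sq_nonneg (u ^ 2 - v ^ 2)]
    -- By `hpq`, `(p + q)² ≤ 4y - y(u - v)²`.
    have hsum : p + q ≤ 2 * r := by
      refine le_of_sq_le_sq ?_ (by linarith)
      have := mul_nonneg hy0.le (sq_nonneg (u - v))
      linarith
    have main : 8 * g r * (r ^ 2 - p * q) +
        (greenPotential g √Q q + greenPotential g √Q p) / 2 ≤ greenPotential g √Q r := by
      rcases le_total p q with h | h
      · have := greenPotential_supersolution hi h0 hcg hmg hp1.1 h hr1.1 hq1.2 hr1.2 hsum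
        linarith
      · have := greenPotential_supersolution hi h0 hcg hmg hq1.1 h hr1.1 hp1.2 hr1.2
          (by linarith)
        linarith
    refine le_trans ?_ main
    have e := sq_g r hr1.1
    rw [r2] at e
    have := mul_le_mul_of_nonneg_left hpq (h0 r)
    rw [← e, r2]
    linarith

end DyadicLattice

/-- The substitution `y = t²`. -/
theorem integral_sub_one_mul_hFun {Φ : ℝ → ℝ} {Q : ℝ} (hQ : 1 ≤ Q) :
    16 * (√Q - 1) * (√Q * hFun Φ √Q) + 16 * ∫ t in (1 : ℝ)..√Q, (t - 1) * hFun Φ t =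
      16 * Φ Q * (1 - 1 / √Q) + 8 * ∫ y in (1 : ℝ)..Q, Φ y / y * (1 - 1 / √y) := by
  have hS : 1 ≤ √Q := Real.one_le_sqrt.2 hQ
  have hS0 : 0 < √Q := by linarith
  have hS2 : √Q ^ 2 = Q := Real.sq_sqrt (by linarith)
  have sub := intervalIntegral.integral_comp_mul_deriv_of_deriv_nonneg (a := 1) (b := √Q)
    (f := fun t => t ^ 2) (f' := fun t => 2 * t) (g := fun y => Φ y / y * (1 - 1 / √y))
    (by fun_prop) (fun t _ => by simpa using hasDerivAt_pow 2 t)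
    (fun t ht => by
      rw [min_eq_left hS] at ht
      linarith [ht.1])
  simp only [one_pow, hS2] at sub
  rw [← sub]
  have e : ∫ t in (1 : ℝ)..√Q, ((fun y => Φ y / y * (1 - 1 / √y)) ∘ fun t => t ^ 2) t * (2 * t) =
      ∫ t in (1 : ℝ)..√Q, 2 * ((t - 1) * hFun Φ t) := by
    refine intervalIntegral.integral_congr fun t ht => ?_
    rw [Set.uIcc_of_le hS] at ht
    have ht0 : 0 < t := by linarith [ht.1]
    simp only [Function.comp, hFun, Real.sqrt_sq ht0.le]
    field_simp
  rw [e, intervalIntegral.integral_const_mul, hFun, hS2]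
  congr 1
  · field_simp
    rw [hS2]
    field_simp
  · ring

/-! ### Increasing `Φ`: lower bound by a random walk. -/

/-- The expected total reward of the simple random walk on `{0, …, n + 1}` started at `k`, absorbed
at `0` and reflected at `n + 1`, with reward `R i` at an interior point `i` and `b` at `n + 1`. -/
noncomputable def walkReward (n : ℕ) (b : ℝ) (R : ℕ → ℝ) (k : ℕ) : ℝ :=
  k * b + 2 * ∑ i ∈ Finset.range (n + 1), ((min i k : ℕ) : ℝ) * R i

theorem walkReward_zero (n : ℕ) (b : ℝ) (R : ℕ → ℝ) : walkReward n b R 0 = 0 := by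
  simp [walkReward]

/-- As a function of `k`, `min i k` has its only kink at `k = i`, with second difference `-1`. -/
theorem walkReward_interior {n : ℕ} (b : ℝ) (R : ℕ → ℝ) {j : ℕ} (hj : j < n) :
    walkReward n b R (j + 1) =
      R (j + 1) + (walkReward n b R j + walkReward n b R (j + 2)) / 2 := by
  have e : ∀ i : ℕ, ((min i (j + 1) : ℕ) : ℝ) =
      (((min i j : ℕ) : ℝ) + ((min i (j + 2) : ℕ) : ℝ)) / 2 + if i = j + 1 then 1 / 2 else 0 := by
    intro i
    rcases lt_trichotomy i (j + 1) with h | h | h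
    · rw [if_neg h.ne, min_eq_left h.le, min_eq_left (by omega), min_eq_left (by omega)]; ring
    · rw [if_pos h, min_eq_left h.le, min_eq_right (by omega), min_eq_left (by omega), h]
      push_cast; ring
    · rw [if_neg h.ne', min_eq_right h.le, min_eq_right (by omega), min_eq_right (by omega)]
      push_cast; ring
  have hs : ∑ i ∈ Finset.range (n + 1), ((min i (j + 1) : ℕ) : ℝ) * R i =
      ((∑ i ∈ Finset.range (n + 1), ((min i j : ℕ) : ℝ) * R i) +
        ∑ i ∈ Finset.range (n + 1), ((min i (j + 2) : ℕ) : ℝ) * R i) / 2 + R (j + 1) / 2 := by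
    have : R (j + 1) / 2 =
        ∑ i ∈ Finset.range (n + 1), if i = j + 1 then R (j + 1) / 2 else 0 := by
      rw [Finset.sum_ite_eq', if_pos (by rw [Finset.mem_range]; omega)]
    rw [this, ← Finset.sum_add_distrib, Finset.sum_div, ← Finset.sum_add_distrib]
    refine Finset.sum_congr rfl fun i _ => ?_
    rw [e i]
    split_ifs with h
    · rw [h]; ring
    · ring
  unfold walkReward
  rw [hs]
  push_cast
  ring

theorem walkReward_top (n : ℕ) (b : ℝ) (R : ℕ → ℝ) :
    walkReward n b R (n + 1) = b + walkReward n b R n := by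
  have : ∑ i ∈ Finset.range (n + 1), ((min i (n + 1) : ℕ) : ℝ) * R i =
      ∑ i ∈ Finset.range (n + 1), ((min i n : ℕ) : ℝ) * R i := by
    refine Finset.sum_congr rfl fun i hi => ?_
    rw [Finset.mem_range] at hi
    rw [min_eq_left hi.le, min_eq_left (by omega)]
  unfold walkReward
  rw [this]
  push_cast
  ring

theorem walkReward_le {n : ℕ} {b : ℝ} {R : ℕ → ℝ} (hR : ∀ i, 0 ≤ R i) (k : ℕ) :
    walkReward n b R k ≤ k * (b + 2 * ∑ i ∈ Finset.range (n + 1), R i) := by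
  have : ∑ i ∈ Finset.range (n + 1), ((min i k : ℕ) : ℝ) * R i ≤
      k * ∑ i ∈ Finset.range (n + 1), R i := by
    rw [Finset.mul_sum]
    exact Finset.sum_le_sum fun i _ => mul_le_mul_of_nonneg_right
      (Nat.cast_le.2 (min_le_right i k)) (hR i)
  unfold walkReward
  linarith

namespace DyadicLattice

variable {D : DyadicLattice} {Φ : ℝ → ℝ} {Q : ℝ}

/-- The walk position `k` stands for `s = 1 + k d`, and `M` for the number of steps before
truncation. The subtracted term bounds the reward lost: `k(2(n+1) - k)` is the expected absorption
time, and it contracts geometrically. -/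
theorem attains_walk (hΦ : ∀ t : ℝ, 1 ≤ t → 0 ≤ Φ t) {n : ℕ} {d : ℝ} (hd : 0 ≤ d)
    (hQ : (1 + (n + 1 : ℕ) * d) ^ 2 = Q) {R : ℕ → ℝ} {b : ℝ}
    (hR : ∀ i : ℕ, R i = 8 * Φ ((1 + i * d) ^ 2) * (d / (1 + i * d)) ^ 2)
    (hb : b = 8 * Φ Q * (1 - (1 + n * d) ^ 2 / Q)) (M k : ℕ) (hk : k ≤ n + 1) {x y : ℝ}
    (hx : 0 < x) (hy : 0 < y) (hxy : x * y = (1 + k * d) ^ 2) :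
    D.Attains Φ Q x y (max 0 (walkReward n b R k - (b + 2 * ∑ i ∈ Finset.range (n + 1), R i) *
      (1 - 1 / ((n : ℝ) + 1) ^ 2) ^ M * (k * (2 * (n + 1) - k)))) := by
  have sq_ge : ∀ i : ℕ, 1 ≤ (1 + (i : ℝ) * d) ^ 2 := fun i =>
    one_le_pow₀ (le_add_of_nonneg_right (by positivity))
  have sq_le : ∀ i : ℕ, i ≤ n + 1 → (1 + (i : ℝ) * d) ^ 2 ≤ Q := fun i hi => by
    rw [← hQ]
    gcongr
  have hQ1 : 1 ≤ Q := (sq_ge 0).trans (sq_le 0 (by omega))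
  have hQ0 : 0 < Q := by linarith
  have hR0 : ∀ i, 0 ≤ R i := fun i => by
    rw [hR]
    exact mul_nonneg (mul_nonneg (by norm_num) (hΦ _ (sq_ge i))) (sq_nonneg _)
  have ratio : 0 ≤ 1 - (1 + (n : ℝ) * d) ^ 2 / Q := by
    rw [sub_nonneg, div_le_one hQ0]; exact sq_le n (by omega)
  have hb0 : 0 ≤ b := by
    rw [hb]; exact mul_nonneg (mul_nonneg (by norm_num) (hΦ _ hQ1)) ratio
  set C := b + 2 * ∑ i ∈ Finset.range (n + 1), R i with hC
  have hC0 : 0 ≤ C := add_nonneg hb0 (mul_nonneg (by norm_num) (Finset.sum_nonneg fun i _ => hR0 i))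
  have zero_case : ∀ {v : ℝ} {k : ℕ} {x y : ℝ}, k ≤ n + 1 → 0 < x → 0 < y →
      x * y = (1 + k * d) ^ 2 → v ≤ 0 → D.Attains Φ Q x y (max 0 v) := by
    intro v k x y hk hx hy hxy hv
    rw [max_eq_left hv]
    exact attains_zero hΦ hQ1 hx hy (hxy ▸ sq_ge k) (hxy ▸ sq_le k hk)
  induction M generalizing k x y with
  | zero =>
    refine zero_case hk hx hy hxy ?_
    have h1 := walkReward_le (n := n) (b := b) hR0 k
    rw [← hC] at h1
    have hk' : (k : ℝ) ≤ n + 1 := by exact_mod_cast hk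
    have hn : (0 : ℝ) ≤ n := by positivity
    have h2 : (k : ℝ) * C ≤ C * (k * (2 * (n + 1) - k)) := by
      have : (k : ℝ) * C * 1 ≤ k * C * (2 * (n + 1) - k) :=
        mul_le_mul_of_nonneg_left (by linarith) (by positivity)
      linarith
    rw [pow_zero, mul_one]
    linarith
  | succ M ih =>
    rcases k with _ | j
    · refine zero_case hk hx hy hxy ?_
      rw [walkReward_zero]; simp
    set ρ : ℝ := 1 - 1 / ((n : ℝ) + 1) ^ 2 with hρ
    have hN : (0 : ℝ) < (n : ℝ) + 1 := by positivity
    have hρ0 : 0 ≤ ρ := by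
      rw [hρ, sub_nonneg, div_le_one (by positivity)]
      exact one_le_pow₀ (by linarith [(Nat.cast_nonneg n : (0 : ℝ) ≤ n)])
    -- One step of the walk lowers `t(2(n+1) - t)` by `1` on average, also at the reflecting end. As
    -- the maximum is `(n+1)²`, this is a contraction by `ρ`.
    have contract : ∀ t : ℝ, t * (2 * (n + 1) - t) - 1 ≤ ρ * (t * (2 * (n + 1) - t)) := by
      intro t
      have : t * (2 * (n + 1) - t) * (1 / ((n : ℝ) + 1) ^ 2) ≤ 1 := by
        rw [mul_one_div, div_le_one (by positivity)]
        linarith [sq_nonneg (n + 1 - t)]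
      rw [hρ]; linarith
    have hCρ : 0 ≤ C * ρ ^ M := by positivity
    have hs0 : 0 < 1 + ((j + 1 : ℕ) : ℝ) * d := by positivity
    rcases (show j < n ∨ j = n by omega) with hj | rfl
    -- Interior move: both averages scale by `1 ± d/s`, so `s` becomes `s ± d`.
    · set s : ℝ := 1 + ((j + 1 : ℕ) : ℝ) * d with hs
      have hds : 0 < 1 - d / s := by
        have : d / s < 1 := by
          rw [div_lt_one hs0, hs]
          push_cast
          have : (0 : ℝ) ≤ j * d := by positivity
          linarith
        linarith
      have h1 := ih j (by omega) (x := x * (1 - d / s)) (y := y * (1 - d / s)) (by positivity)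
        (by positivity) (by
          rw [show x * (1 - d / s) * (y * (1 - d / s)) = x * y * (1 - d / s) ^ 2 by ring, hxy,
            ← mul_pow]
          congr 1
          field_simp
          rw [hs]; push_cast; ring)
      have h2 := ih (j + 2) (by omega) (x := x * (1 + d / s)) (y := y * (1 + d / s)) (by positivity)
        (by positivity) (by
          rw [show x * (1 + d / s) * (y * (1 + d / s)) = x * y * (1 + d / s) ^ 2 by ring, hxy,
            ← mul_pow]
          congr 1
          field_simp
          rw [hs]; push_cast; ring)
      refine (Attains.glue hΦ h1 h2 (by ring) (by ring) (hxy ▸ sq_le _ hk) (le_max_left _ _)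
        (le_max_left _ _)).mono ?_
      have e : Φ (x * y) * ((x * (1 - d / s) - x * (1 + d / s)) ^ 2 / x ^ 2 +
          (y * (1 - d / s) - y * (1 + d / s)) ^ 2 / y ^ 2) = R (j + 1) := by
        rw [hR, ← hs, hxy]
        field_simp
        ring
      rw [e]
      refine max_le (add_nonneg (hR0 _) (by positivity)) ?_
      refine le_trans ?_ (add_le_add_right (div_le_div_of_nonneg_right
        (add_le_add (le_max_right _ _) (le_max_right _ _)) (by norm_num)) _)
      rw [walkReward_interior b R hj, pow_succ]
      have := mul_le_mul_of_nonneg_left (contract ((j + 1 : ℕ) : ℝ)) hCρ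
      push_cast at this ⊢
      linarith
    -- Reflection: scaling by `(1 ± e, 1 ∓ e)` sends both halves from `√Q` to `1 + j d`, one step
    -- below the top.
    · set e := √(1 - (1 + (j : ℝ) * d) ^ 2 / Q)
      have e2 : e ^ 2 = 1 - (1 + (j : ℝ) * d) ^ 2 / Q := Real.sq_sqrt ratio
      have e0 : 0 ≤ e := Real.sqrt_nonneg _
      have e1 : e < 1 := by
        have : 0 < (1 + (j : ℝ) * d) ^ 2 / Q := div_pos (by linarith [sq_ge j]) hQ0
        nlinarith
      have em : 0 < 1 - e := by linarith
      rw [hQ] at hxy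
      have key : x * y * (1 - e ^ 2) = (1 + (j : ℝ) * d) ^ 2 := by
        rw [e2, hxy]; field_simp; ring
      have h1 := ih j (by omega) (x := x * (1 + e)) (y := y * (1 - e)) (by positivity)
        (by positivity) (by rw [← key]; ring)
      have h2 := ih j (by omega) (x := x * (1 - e)) (y := y * (1 + e)) (by positivity)
        (by positivity) (by rw [← key]; ring)
      refine (Attains.glue hΦ h1 h2 (by ring) (by ring) hxy.le (le_max_left _ _)
        (le_max_left _ _)).mono ?_
      have eb : Φ (x * y) * ((x * (1 + e) - x * (1 - e)) ^ 2 / x ^ 2 +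
          (y * (1 - e) - y * (1 + e)) ^ 2 / y ^ 2) = b := by
        rw [hb, ← e2, hxy]
        field_simp
        ring
      rw [eb]
      refine max_le (add_nonneg hb0 (by positivity)) ?_
      refine le_trans ?_ (add_le_add_right (div_le_div_of_nonneg_right
        (add_le_add (le_max_right _ _) (le_max_right _ _)) (by norm_num)) _)
      rw [walkReward_top, pow_succ]
      have := mul_le_mul_of_nonneg_left (contract ((j + 1 : ℕ) : ℝ)) hCρ
      push_cast at this ⊢
      linarith

theorem walkReward_le_upperK (hΦ : ∀ t : ℝ, 1 ≤ t → 0 ≤ Φ t) {n : ℕ} {d : ℝ} (hd : 0 ≤ d)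
    (hQ : (1 + (n + 1 : ℕ) * d) ^ 2 = Q) :
    ENNReal.ofReal (walkReward n (8 * Φ Q * (1 - (1 + n * d) ^ 2 / Q))
      (fun i => 8 * Φ ((1 + i * d) ^ 2) * (d / (1 + i * d)) ^ 2) (n + 1)) ≤ upperK D Φ Q := by
  have hs : (0 : ℝ) < 1 + (n + 1 : ℕ) * d := by positivity
  have hQ0 : 0 < Q := by rw [← hQ]; positivity
  have h := fun M => (attains_walk (D := D) hΦ hd hQ (fun _ => rfl) rfl M (n + 1) le_rfl
    (x := 1) (y := Q) one_pos hQ0 (by rw [hQ, one_mul])).mono (le_max_right _ _)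
  have hn : (0 : ℝ) ≤ n := Nat.cast_nonneg n
  have lim := tendsto_pow_atTop_nhds_zero_of_lt_one (r := 1 - 1 / ((n : ℝ) + 1) ^ 2)
    (by rw [sub_nonneg, div_le_one (by positivity)]; exact one_le_pow₀ (by linarith))
    (by linarith [show 0 < 1 / ((n : ℝ) + 1) ^ 2 by positivity])
  have lim2 := ((lim.const_mul (8 * Φ Q * (1 - (1 + n * d) ^ 2 / Q) +
    2 * ∑ i ∈ Finset.range (n + 1), 8 * Φ ((1 + i * d) ^ 2) * (d / (1 + i * d)) ^ 2)).mul_const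
    (((n + 1 : ℕ) : ℝ) * (2 * (n + 1) - (n + 1 : ℕ)))).const_sub
    (walkReward n (8 * Φ Q * (1 - (1 + n * d) ^ 2 / Q))
      (fun i => 8 * Φ ((1 + i * d) ^ 2) * (d / (1 + i * d)) ^ 2) (n + 1))
  rw [mul_zero, zero_mul, sub_zero] at lim2
  exact le_of_tendsto (ENNReal.tendsto_ofReal lim2)
    (Filter.Eventually.of_forall fun M => (h M).le_upperK (one_mul Q))

end DyadicLattice

theorem MonotoneOn.intervalIntegrable_sub_one_mul_hFun {Φ : ℝ → ℝ}
    (hm : MonotoneOn Φ (Set.Ici 1)) {a b : ℝ} (ha : 1 ≤ a) (hb : 1 ≤ b) :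
    IntervalIntegrable (fun t => (t - 1) * hFun Φ t) volume a b := by
  have hs : ∀ t ∈ Set.uIcc a b, 1 ≤ t := fun t ht => (le_inf ha hb).trans ht.1
  have h1 : MonotoneOn (fun t : ℝ => Φ (t ^ 2)) (Set.uIcc a b) := fun s hs' t ht hst =>
    hm (one_le_pow₀ (hs s hs')) (one_le_pow₀ (hs t ht))
      (pow_le_pow_left₀ (by linarith [hs s hs']) hst 2)
  have h2 : ContinuousOn (fun t : ℝ => (t - 1) / t ^ 2) (Set.uIcc a b) :=
    ContinuousOn.div (by fun_prop) (by fun_prop) fun t ht =>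
      pow_ne_zero 2 (by linarith [hs t ht])
  refine (h1.intervalIntegrable.mul_continuousOn h2).congr fun t _ => ?_
  simp only [hFun]
  ring

/-- `h` itself need not be monotone. On a cell with right end `s`, `Φ(t²) ≤ Φ(s²)` and `s ≤ (1 + d)
t`, which is where the factor `(1 + d)²` comes from. -/
theorem integral_sub_one_mul_hFun_le_sum {Φ : ℝ → ℝ} (hΦ : ∀ t : ℝ, 1 ≤ t → 0 ≤ Φ t)
    (hm : MonotoneOn Φ (Set.Ici 1)) {d : ℝ} (hd : 0 ≤ d) (N : ℕ) :
    ∫ t in (1 : ℝ)..(1 + N * d), (t - 1) * hFun Φ t ≤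
      (1 + d) ^ 2 * ∑ k ∈ Finset.range (N + 1), k * d * hFun Φ (1 + k * d) * d := by
  have ge : ∀ k : ℕ, 1 ≤ 1 + (k : ℝ) * d := fun k => le_add_of_nonneg_right (by positivity)
  have total : ∑ k ∈ Finset.range N,
      ∫ t in (1 + (k : ℕ) * d)..(1 + (k + 1 : ℕ) * d), (t - 1) * hFun Φ t =
      ∫ t in (1 : ℝ)..(1 + N * d), (t - 1) * hFun Φ t := by
    rw [intervalIntegral.sum_integral_adjacent_intervals (a := fun k : ℕ => 1 + (k : ℝ) * d)]
    · simp
    · exact fun k _ => hm.intervalIntegrable_sub_one_mul_hFun (ge _) (ge _)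
  have piece : ∀ k : ℕ, ∫ t in (1 + (k : ℕ) * d)..(1 + (k + 1 : ℕ) * d), (t - 1) * hFun Φ t ≤
      (1 + d) ^ 2 * ((k + 1 : ℕ) * d * hFun Φ (1 + (k + 1 : ℕ) * d) * d) := by
    intro k
    have hle : 1 + (k : ℝ) * d ≤ 1 + (k + 1 : ℕ) * d := by push_cast; linarith
    have := intervalIntegral.integral_mono_on hle
      (hm.intervalIntegrable_sub_one_mul_hFun (ge k) (ge (k + 1)))
      (intervalIntegrable_const
        (c := (1 + d) ^ 2 * ((k + 1 : ℕ) * d * hFun Φ (1 + (k + 1 : ℕ) * d)))) fun t ht => by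
        have ht1 : 1 ≤ t := (ge k).trans ht.1
        have ht0 : 0 < t := by linarith
        set s : ℝ := 1 + (k + 1 : ℕ) * d with hs
        have hs1 : 1 ≤ s := ht1.trans ht.2
        have hs0 : 0 < s := by linarith
        have hst : s ≤ (1 + d) * t := by
          have h1 : s = 1 + k * d + d := by rw [hs]; push_cast; ring
          have h2 := mul_nonneg hd (sub_nonneg.2 ht1)
          linarith [ht.1]
        have hsq : s ^ 2 ≤ (1 + d) ^ 2 * t ^ 2 := by
          rw [← mul_pow]; exact pow_le_pow_left₀ hs0.le hst 2
        have hΦst : Φ (t ^ 2) ≤ Φ (s ^ 2) :=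
          hm (one_le_pow₀ ht1) (one_le_pow₀ hs1) (pow_le_pow_left₀ ht0.le ht.2 2)
        have hΦs := hΦ _ (one_le_pow₀ hs1 (n := 2))
        have e : ((k + 1 : ℕ) : ℝ) * d = s - 1 := by rw [hs]; ring
        rw [e, hFun, hFun, mul_div_assoc', mul_div_assoc', mul_div_assoc',
          div_le_div_iff₀ (by positivity) (by positivity)]
        calc (t - 1) * Φ (t ^ 2) * s ^ 2 ≤ (s - 1) * Φ (s ^ 2) * ((1 + d) ^ 2 * t ^ 2) :=
              mul_le_mul (mul_le_mul (by linarith [ht.2]) hΦst (hΦ _ (one_le_pow₀ ht1))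
                (by linarith)) hsq (by positivity) (mul_nonneg (by linarith) hΦs)
          _ = (1 + d) ^ 2 * ((s - 1) * Φ (s ^ 2)) * t ^ 2 := by ring
    refine this.trans (le_of_eq ?_)
    rw [intervalIntegral.integral_const, smul_eq_mul]
    push_cast
    ring
  rw [← total, Finset.sum_range_succ']
  refine (Finset.sum_le_sum fun k _ => piece k).trans (le_of_eq ?_)
  rw [← Finset.mul_sum]
  simp

namespace DyadicLattice

variable {D : DyadicLattice} {Φ : ℝ → ℝ} {Q : ℝ}

theorem le_upperK_of_monotoneOn (hΦ : ∀ t : ℝ, 1 ≤ t → 0 ≤ Φ t) (hQ : 1 ≤ Q)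
    (hm : MonotoneOn Φ (Set.Ici 1)) :
    ENNReal.ofReal (16 * (√Q - 1) * (√Q * hFun Φ √Q) +
      16 * ∫ t in (1 : ℝ)..√Q, (t - 1) * hFun Φ t) ≤ upperK D Φ Q := by
  set S := √Q with hS
  have hS1 : 1 ≤ S := Real.one_le_sqrt.2 hQ
  have hS0 : 0 < S := by linarith
  have hS2 : S ^ 2 = Q := Real.sq_sqrt (by linarith)
  set I := ∫ t in (1 : ℝ)..S, (t - 1) * hFun Φ t with hI
  -- Here `d = (S - 1)/(n + 1)`. The top rewards tend to `16 (S - 1) S h(S)`. The interior rewards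
  -- omit the grid point `S`, whence the vanishing term `(S - 1) h(S) d`.
  have key : ∀ n : ℕ, ENNReal.ofReal (8 * hFun Φ S * (S - 1) * (2 * S - (S - 1) * (1 / (n + 1))) +
      16 * (I / (1 + (S - 1) * (1 / (n + 1))) ^ 2 -
        (S - 1) * hFun Φ S * ((S - 1) * (1 / (n + 1))))) ≤ upperK D Φ Q := by
    intro n
    set d : ℝ := (S - 1) * (1 / ((n : ℝ) + 1)) with hd
    have hd0 : 0 ≤ d := mul_nonneg (by linarith) (by positivity)
    have hnd : ((n + 1 : ℕ) : ℝ) * d = S - 1 := by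
      rw [hd]; push_cast; field_simp
    have hNS : 1 + ((n + 1 : ℕ) : ℝ) * d = S := by rw [hnd]; ring
    refine le_trans (ENNReal.ofReal_le_ofReal ?_)
      (walkReward_le_upperK (D := D) hΦ hd0 (by rw [hNS, hS2]))
    have sum := integral_sub_one_mul_hFun_le_sum hΦ hm hd0 (n + 1)
    rw [hNS, ← hI, mul_comm, ← div_le_iff₀ (by positivity), Finset.sum_range_succ, hNS, hnd] at sum
    have e1 : ∑ i ∈ Finset.range (n + 1), ((min i (n + 1) : ℕ) : ℝ) *
        (8 * Φ ((1 + i * d) ^ 2) * (d / (1 + i * d)) ^ 2) =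
        8 * ∑ k ∈ Finset.range (n + 1), k * d * hFun Φ (1 + k * d) * d := by
      rw [Finset.mul_sum]
      refine Finset.sum_congr rfl fun i hi => ?_
      rw [min_eq_left (Finset.mem_range.1 hi).le, hFun, div_pow]
      ring
    have e2 : ((n + 1 : ℕ) : ℝ) * (8 * Φ Q * (1 - (1 + n * d) ^ 2 / Q)) =
        8 * hFun Φ S * (S - 1) * (2 * S - d) := by
      have h1 : 1 + (n : ℝ) * d = S - d := by
        rw [← hNS]; push_cast; ring
      have h2 : 1 - (S - d) ^ 2 / S ^ 2 = d * (2 * S - d) / S ^ 2 := by field_simp; ring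
      rw [h1, ← hS2, h2, hFun, ← hnd]
      ring
    unfold walkReward
    rw [e1, e2]
    linarith
  have l0 := (tendsto_one_div_add_atTop_nhds_zero_nat (𝕜 := ℝ)).const_mul (S - 1)
  rw [mul_zero] at l0
  have lim := ((l0.const_sub (2 * S)).const_mul (8 * hFun Φ S * (S - 1))).add
    (((tendsto_const_nhds (x := I)).div ((l0.const_add 1).pow 2) (by norm_num)).sub
      (l0.const_mul ((S - 1) * hFun Φ S)) |>.const_mul 16)
  have lim' := ENNReal.tendsto_ofReal lim
  refine (le_of_eq ?_).trans (le_of_tendsto lim' (Filter.Eventually.of_forall key))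
  congr 1
  ring

end DyadicLattice

/-! ### Concave `h`: tangent majorant. -/

theorem ConcaveOn.exists_le_affine_of_mem_interior {h : ℝ → ℝ} {s : Set ℝ} (hc : ConcaveOn ℝ s h)
    {a : ℝ} (ha : a ∈ interior s) : ∃ m : ℝ, ∀ t ∈ s, h t ≤ h a + m * (t - a) := by
  have hf := hc.neg
  refine ⟨-derivWithin (-h) (Set.Ioi a) a, fun t ht => ?_⟩
  rcases lt_trichotomy t a with hta | rfl | hat
  · have h1 := (hf.slope_le_leftDeriv_of_mem_interior ht ha hta).trans
      (hf.leftDeriv_le_rightDeriv_of_mem_interior ha)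
    rw [slope_def_field, div_le_iff₀ (sub_pos.2 hta)] at h1
    simp only [Pi.neg_apply] at h1
    linarith
  · simp
  · have h1 := hf.rightDeriv_le_slope_of_mem_interior ha ht hat
    rw [slope_def_field, le_div_iff₀ (sub_pos.2 hat)] at h1
    simp only [Pi.neg_apply] at h1
    linarith

/-- A tangent of negative slope would force `h` below zero; the point chosen is where the tangent
equals `-1`. -/
theorem ConcaveOn.exists_nonneg_slope {h : ℝ → ℝ} {c : ℝ} (hc : ConcaveOn ℝ (Set.Ici c) h)
    (h0 : ∀ t, c ≤ t → 0 ≤ h t) {a : ℝ} (ha : c < a) :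
    ∃ m : ℝ, 0 ≤ m ∧ ∀ t, c ≤ t → h t ≤ h a + m * (t - a) := by
  obtain ⟨m, hm⟩ := hc.exists_le_affine_of_mem_interior (a := a) (by rwa [interior_Ici])
  refine ⟨m, ?_, hm⟩
  by_contra! hneg
  have hpos : 0 ≤ (h a + 1) / (-m) := div_nonneg (by linarith [h0 a ha.le]) (by linarith)
  have h1 := h0 (a + (h a + 1) / (-m)) (by linarith)
  have h2 := hm (a + (h a + 1) / (-m)) (by rw [Set.mem_Ici]; linarith)
  have h3 : m * (a + (h a + 1) / (-m) - a) = -(h a + 1) := by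
    have : m ≠ 0 := hneg.ne
    field_simp
    ring
  linarith

/-- The left side integrates an affine function against a positive measure of mass `8(√Q - 1)(3√Q -
1)`. For `Q > 1`, `sZero Q` is the barycentre, so the slope `m` disappears. -/
theorem sZero_affine_identity {Q A m : ℝ} (hQ : 1 ≤ Q) :
    16 * (√Q - 1) * (√Q * (A + m * (√Q - sZero Q))) +
      16 * ∫ t in (1 : ℝ)..√Q, (t - 1) * (A + m * (t - sZero Q)) =
      8 * (√Q - 1) * (3 * √Q - 1) * A := by
  have hS : 1 ≤ √Q := Real.one_le_sqrt.2 hQ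
  have hS2 : √Q ^ 2 = Q := Real.sq_sqrt (by linarith)
  have hs0 : sZero Q * (3 * (3 * √Q - 1)) = 8 * √Q ^ 2 - √Q - 1 := by
    rw [sZero, hS2]
    exact div_mul_cancel₀ _ (by linarith)
  generalize sZero Q = σ at *
  have e : ∫ t in (1 : ℝ)..√Q, (t - 1) * (A + m * (t - σ)) =
      ((√Q - 1) ^ 2 / 2 * (A + m * (1 - σ)) + m * (√Q - 1) ^ 3 / 3) := by
    rw [intervalIntegral.integral_eq_sub_of_hasDerivAt
      (f := fun t => (t - 1) ^ 2 / 2 * (A + m * (1 - σ)) + m * (t - 1) ^ 3 / 3)]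
    · ring
    · intro t _
      have h1 : HasDerivAt (fun t : ℝ => t - 1) 1 t := (hasDerivAt_id t).sub_const 1
      exact ((((h1.pow 2).div_const 2).mul_const (A + m * (1 - σ))).add
        (((h1.pow 3).const_mul m).div_const 3)).congr_deriv (by push_cast; ring)
    · exact Continuous.intervalIntegrable (by fun_prop) _ _
  rw [e]
  linear_combination (-8 / 3) * m * (√Q - 1) * hs0

namespace DyadicLattice

variable {D : DyadicLattice} {Φ : ℝ → ℝ} {Q : ℝ}

theorem upperK_one (hΦ : ∀ t : ℝ, 1 ≤ t → 0 ≤ Φ t) : upperK D Φ 1 = 0 := by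
  have := D.upperK_le_of_supersolution (b := fun _ => 0) le_rfl hΦ (fun _ _ => le_rfl)
    (fun _ _ => le_rfl) (by
      intro y u v _ _ hy hp hm
      rw [Set.Icc_self, Set.mem_singleton_iff] at hy hp hm
      subst hy
      have h1 : u * v = 0 := by linarith
      have h2 : u ^ 2 + v ^ 2 = 0 := by
        have : u + v = 0 := by linarith
        have : (u + v) ^ 2 = 0 := by rw [this]; ring
        linarith
      rw [h2]
      simp)
  rwa [ENNReal.ofReal_zero, nonpos_iff_eq_zero] at this

theorem upperK_le_of_concaveOn (hΦ : ∀ t : ℝ, 1 ≤ t → 0 ≤ Φ t) (hQ : 1 ≤ Q)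
    (hc : ConcaveOn ℝ (Set.Ici 1) (hFun Φ)) :
    upperK D Φ Q ≤ ENNReal.ofReal (8 * (√Q - 1) * (3 * √Q - 1) * hFun Φ (sZero Q)) := by
  rcases hQ.eq_or_lt with rfl | hQ1
  · rw [upperK_one hΦ]; exact zero_le
  have hS : 1 < √Q := Real.lt_sqrt_of_sq_lt (by linarith)
  have hS2 : √Q ^ 2 = Q := Real.sq_sqrt (by linarith)
  -- The tangent needs an interior point of `[1, ∞)`, hence the separate case `Q = 1`.
  have hσ : 1 < sZero Q := by
    rw [sZero, lt_div_iff₀ (by linarith)]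
    nlinarith
  have hh : ∀ t, 1 ≤ t → 0 ≤ hFun Φ t := fun t ht =>
    div_nonneg (hΦ _ (one_le_pow₀ ht)) (sq_nonneg t)
  obtain ⟨m, hm0, hm⟩ := hc.exists_nonneg_slope hh hσ
  set A := hFun Φ (sZero Q)
  -- `Ψ` is the function whose `h` is the tangent line. It dominates `Φ`, and it increases because
  -- `m ≥ 0`.
  set Ψ : ℝ → ℝ := fun y => y * (A + m * (√y - sZero Q)) with hΨ
  have aff : ∀ t, 1 ≤ t → hFun Ψ t = A + m * (t - sZero Q) := by
    intro t ht
    have : t ≠ 0 := by linarith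
    simp only [hFun, hΨ, Real.sqrt_sq (zero_le_one.trans ht)]
    field_simp
  have aff0 : ∀ y, 1 ≤ y → 0 ≤ A + m * (√y - sZero Q) := fun y hy =>
    (hh _ (Real.one_le_sqrt.2 hy)).trans (hm _ (Real.one_le_sqrt.2 hy))
  have hle : ∀ y, 1 ≤ y → Φ y ≤ Ψ y := by
    intro y hy
    have h1 := hm _ (Real.one_le_sqrt.2 hy)
    rw [hFun, Real.sq_sqrt (by linarith), div_le_iff₀ (by linarith)] at h1
    rw [hΨ]
    linarith
  have hΨm : MonotoneOn Ψ (Set.Ici 1) := fun s hs t ht hst =>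
    mul_le_mul hst (by have := mul_le_mul_of_nonneg_left (Real.sqrt_le_sqrt hst) hm0; linarith)
      (aff0 s hs) (zero_le_one.trans ht)
  have hΨc : ConvexOn ℝ (Set.Ici 1) (hFun Ψ) := by
    refine ConvexOn.congr ⟨convex_Ici 1, fun s _ t _ a b _ _ hab => le_of_eq ?_⟩
      (f := fun t => A + m * (t - sZero Q)) fun t ht => (aff t ht).symm
    simp only [smul_eq_mul]
    linear_combination (m * sZero Q - A) * hab
  refine (upperK_mono hle).trans ((upperK_le_of_convexOn
    (fun t ht => (hΦ t ht).trans (hle t ht)) hQ hΨm hΨc).trans (le_of_eq ?_))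
  rw [← sZero_affine_identity (A := A) (m := m) hQ, aff _ hS.le]
  congr 3
  refine intervalIntegral.integral_congr fun t ht => ?_
  rw [Set.uIcc_of_le hS.le] at ht
  simp only [aff t ht.1]

end DyadicLattice

theorem theorem2p1 (D : DyadicLattice) (Φ : ℝ → ℝ) (hΦ : ∀ t : ℝ, 1 ≤ t → 0 ≤ Φ t)
    (Q : ℝ) (hQ : 1 ≤ Q) :
    (MonotoneOn Φ (Set.Ici 1) → ConvexOn ℝ (Set.Ici 1) (hFun Φ) →
      upperK D Φ Q = ENNReal.ofReal
        (16 * Φ Q * (1 - 1 / √Q) + 8 * ∫ y in (1 : ℝ)..Q, Φ y / y * (1 - 1 / √y))) ∧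
    (MonotoneOn Φ (Set.Ici 1) → ConcaveOn ℝ (Set.Ici 1) (hFun Φ) →
      upperK D Φ Q ≤ ENNReal.ofReal
        (8 * (√Q - 1) * (3 * √Q - 1) * hFun Φ (sZero Q))) ∧
    (AntitoneOn Φ (Set.Ici 1) →
      upperK D Φ Q = ENNReal.ofReal (8 * ∫ y in (1 : ℝ)..Q, Φ y / y)) := by
  refine ⟨fun hm hc => ?_, fun _ hc => DyadicLattice.upperK_le_of_concaveOn hΦ hQ hc, fun h => ?_⟩
  · rw [← integral_sub_one_mul_hFun hQ]
    exact le_antisymm (DyadicLattice.upperK_le_of_convexOn hΦ hQ hm hc)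
      (DyadicLattice.le_upperK_of_monotoneOn hΦ hQ hm)
  · exact le_antisymm (DyadicLattice.upperK_le_of_antitoneOn hΦ hQ h)
      (DyadicLattice.le_upperK_of_antitoneOn hΦ hQ h)
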